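/- All graphs are finite and simple. A bipartite graph $G=(X\cup Y,E)$ is a *bipartite chain graph* if $X$ and $Y$ can be ordered as $x_1,\dots,x_p$ and $y_1,\dots,y_q$ with $N(x_p)\subseteq\dots\subseteq N(x_1)$ and $N(y_q)\subseteq\dots\subseteq N(y_1)$. A partition $V_1,\dots,V_k$ of the vertex set of $G$ into nonempty parts is *transitive* if, for all $i<j$, every vertex of $V_j$ is adjacent to some vertex of $V_i$, and *$d_2$-transitive* if, for all $i<j$, every vertex of $V_j$ is at distance at most $2$ from some vertex of $V_i$. The largest possible $k$ is the transitivity $Tr(G)$, respectively the $d_2$-transitivity $Tr_{d_2}(G)$. The square $G^2$ has the same vertices as $G$, two distinct vertices being adjacent when their distance in $G$ is at most $2$. *Linear time* means $O(|V|+|E|+1)$ steps of a random access machine (whose words have $\log_2(|V|+|E|+1)+O(1)$ bits) on a graph given by adjacency lists. **Theorem.** 1. The Maximum $d_2$-Transitivity Problem is solvable in linear time on bipartite chain graphs: there is a linear-time algorithm that, given any bipartite chain graph $G$, outputs $Tr_{d_2}(G)$ and a $d_2$-transitive partition of $G$ of order $Tr_{d_2}(G)$. 2. If $G$ is a connected bipartite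 chain graph, then there is a bipartite chain graph $H$ on the same vertex set with $G^2=\overline{H}$. 3. There is a linear-time algorithm that, given any graph $G$ that is the complement of a bipartite chain graph, outputs the transitivity $Tr(G)$. -/

import Mathlib

namespace D2Transitivity

/-! ### Graphs -/

section Graphs

universe u

variable {V : Type u}

/-- `G` is a bipartite chain graph: its vertex set is partitioned into two independent sets
`X`, `Y` (possibly empty), and each of them can be listed so that the neighbourhoods decrease:
`N(x₁) ⊇ N(x₂) ⊇ ⋯` and `N(y₁) ⊇ N(y₂) ⊇ ⋯`. -/
def IsBipartiteChain (G : SimpleGraph V) : Prop :=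
  ∃ X Y : Set V, G.IsBipartiteWith X Y ∧ X ∪ Y = Set.univ ∧
    ∃ (p q : ℕ) (σ : Fin p ≃ X) (τ : Fin q ≃ Y),
      Antitone (fun i => G.neighborSet (σ i : V)) ∧
      Antitone (fun i => G.neighborSet (τ i : V))

/-- The square of a graph: distinct vertices are joined when their distance is at most two.
(`SimpleGraph.edist` is `⊤` between different components.) -/
def square (G : SimpleGraph V) : SimpleGraph V where
  Adj u v := u ≠ v ∧ G.edist u v ≤ 2
  symm := ⟨fun u v h => ⟨h.1.symm, by rw [SimpleGraph.edist_comm]; exact h.2⟩⟩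
  loopless := ⟨fun _ h => h.1 rfl⟩

/-- `A` dominates `B`: every vertex of `B` is adjacent to some vertex of `A`. -/
def Dominates (G : SimpleGraph V) (A B : Set V) : Prop :=
  ∀ b ∈ B, ∃ a ∈ A, G.Adj a b

/-- `A` `d₂`-dominates `B`: every vertex of `B` is at distance at most two from some vertex
of `A`. -/
def D2Dominates (G : SimpleGraph V) (A B : Set V) : Prop :=
  ∀ b ∈ B, ∃ a ∈ A, G.edist a b ≤ 2

/-- `P 0, …, P (k-1)` are nonempty, pairwise disjoint, and cover the vertex set. -/
def IsVertexPartition {k : ℕ} (P : Fin k → Set V) : Prop :=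
  (∀ i, (P i).Nonempty) ∧ (∀ i j, i ≠ j → Disjoint (P i) (P j)) ∧ (⋃ i, P i) = Set.univ

/-- A transitive partition of order `k`. -/
def IsTransitivePartition (G : SimpleGraph V) {k : ℕ} (P : Fin k → Set V) : Prop :=
  IsVertexPartition P ∧ ∀ i j, i < j → Dominates G (P i) (P j)

/-- A `d₂`-transitive partition of order `k`. -/
def IsD2TransitivePartition (G : SimpleGraph V) {k : ℕ} (P : Fin k → Set V) : Prop :=
  IsVertexPartition P ∧ ∀ i j, i < j → D2Dominates G (P i) (P j)

/-- The transitivity `Tr(G)`: the largest order of a transitive partition. -/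
noncomputable def transitivity (G : SimpleGraph V) : ℕ :=
  sSup {k | ∃ P : Fin k → Set V, IsTransitivePartition G P}

/-- The `d₂`-transitivity `Tr_{d₂}(G)`: the largest order of a `d₂`-transitive partition. -/
noncomputable def d2Transitivity (G : SimpleGraph V) : ℕ :=
  sSup {k | ∃ P : Fin k → Set V, IsD2TransitivePartition G P}

theorem IsVertexPartition.le_card [Finite V] {k : ℕ} {P : Fin k → Set V}
    (h : IsVertexPartition P) : k ≤ Nat.card V := by
  choose f hf using h.1
  have hinj : Function.Injective f := fun i j hij => by
    by_contra hne
    exact Set.disjoint_left.1 (h.2.1 i j hne) (hf i) (hij ▸ hf j)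
  simpa using Nat.card_le_card_of_injective f hinj

theorem exists_trivial_partition (V : Type u) : ∃ k ≤ 1, ∃ P : Fin k → Set V,
    IsVertexPartition P := by
  rcases isEmpty_or_nonempty V with hV | hV
  · exact ⟨0, by simp, fun _ => Set.univ, fun i => i.elim0, fun i => i.elim0,
      Subsingleton.elim _ _⟩
  · exact ⟨1, le_rfl, fun _ => Set.univ, fun _ => Set.univ_nonempty,
      fun i j hij => absurd (Subsingleton.elim i j) hij, Set.iUnion_const _⟩

/-- On finite graphs the supremum defining `Tr(G)` is a maximum. -/
theorem isGreatest_transitivity [Finite V] (G : SimpleGraph V) :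
    IsGreatest {k | ∃ P : Fin k → Set V, IsTransitivePartition G P} (transitivity G) := by
  have hb : BddAbove {k | ∃ P : Fin k → Set V, IsTransitivePartition G P} :=
    ⟨Nat.card V, fun k ⟨_, hP⟩ => hP.1.le_card⟩
  obtain ⟨k, hk, P, hP⟩ := exists_trivial_partition V
  exact ⟨Nat.sSup_mem ⟨k, P, hP, fun i j hij => by omega⟩ hb, fun k hk => le_csSup hb hk⟩

/-- On finite graphs the supremum defining `Tr_{d₂}(G)` is a maximum. -/
theorem isGreatest_d2Transitivity [Finite V] (G : SimpleGraph V) :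
    IsGreatest {k | ∃ P : Fin k → Set V, IsD2TransitivePartition G P} (d2Transitivity G) := by
  have hb : BddAbove {k | ∃ P : Fin k → Set V, IsD2TransitivePartition G P} :=
    ⟨Nat.card V, fun k ⟨_, hP⟩ => hP.1.le_card⟩
  obtain ⟨k, hk, P, hP⟩ := exists_trivial_partition V
  exact ⟨Nat.sSup_mem ⟨k, P, hP, fun i j hij => by omega⟩ hb, fun k hk => le_csSup hb hk⟩

end Graphs

/-! ### The machine model: a random access machine on words of bounded size -/

/-- A machine state: registers and a random access memory, both holding natural numbers. -/
structure State where
  reg : ℕ → ℕ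
  mem : ℕ → ℕ

/-- The operations whose result can be put into a register. The arguments `a`, `b` are names of
registers; `load a` reads the memory cell whose address is in register `a`. -/
inductive Operation where
  | const (k : ℕ)
  | copy (a : ℕ)
  | add (a b : ℕ)
  | sub (a b : ℕ)
  | load (a : ℕ)

/-- The value of an operation; subtraction is truncated at `0`. -/
def Operation.eval (s : State) : Operation → ℕ
  | .const k => k
  | .copy a => s.reg a
  | .add a b => s.reg a + s.reg b
  | .sub a b => s.reg a - s.reg b
  | .load a => s.mem (s.reg a)

/-- Programs. `assign r e` puts the value of `e` into register `r`; `store a b` writes register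
`b` into the memory cell whose address is in register `a`; `branch a b p q` runs `p` if
register `a` is smaller than register `b`, and `q` otherwise; `loop a b p` repeats `p` as long as
register `a` is smaller than register `b`. -/
inductive Program where
  | skip
  | assign (r : ℕ) (e : Operation)
  | store (a b : ℕ)
  | seq (p q : Program)
  | branch (a b : ℕ) (p q : Program)
  | loop (a b : ℕ) (p : Program)

/-- `Exec W p s t s'`: on a machine whose words hold the numbers `0, …, W - 1`, the program `p`
started in state `s` halts in state `s'` after exactly `t` steps. Every operation, memory access
and comparison is one step. A program that produces a number `≥ W` gets stuck: it has no
execution. -/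
inductive Exec (W : ℕ) : Program → State → ℕ → State → Prop where
  | skip (s : State) : Exec W .skip s 1 s
  | assign (r : ℕ) (e : Operation) (s : State) (h : e.eval s < W) :
      Exec W (.assign r e) s 1 { s with reg := Function.update s.reg r (e.eval s) }
  | store (a b : ℕ) (s : State) :
      Exec W (.store a b) s 1 { s with mem := Function.update s.mem (s.reg a) (s.reg b) }
  | seq {p q : Program} {s s' s'' : State} {t t' : ℕ}
      (hp : Exec W p s t s') (hq : Exec W q s' t' s'') : Exec W (.seq p q) s (t + t') s''
  | branch_true {a b : ℕ} {p : Program} (q : Program) {s s' : State} {t : ℕ}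
      (h : s.reg a < s.reg b) (hp : Exec W p s t s') : Exec W (.branch a b p q) s (t + 1) s'
  | branch_false {a b : ℕ} (p : Program) {q : Program} {s s' : State} {t : ℕ}
      (h : ¬ s.reg a < s.reg b) (hq : Exec W q s t s') : Exec W (.branch a b p q) s (t + 1) s'
  | loop_true {a b : ℕ} {p : Program} {s s' s'' : State} {t t' : ℕ}
      (h : s.reg a < s.reg b) (hp : Exec W p s t s') (hl : Exec W (.loop a b p) s' t' s'') :
      Exec W (.loop a b p) s (t + t' + 1) s''
  | loop_false {a b : ℕ} (p : Program) {s : State} (h : ¬ s.reg a < s.reg b) :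
      Exec W (.loop a b p) s 1 s

/-! ### Graph problems solved in linear time -/

/-- `L v` lists the neighbours of `v`, in any order and without repetition. -/
def IsAdjacencyLists {n : ℕ} (G : SimpleGraph (Fin n)) (L : Fin n → List (Fin n)) : Prop :=
  ∀ v, (L v).Nodup ∧ ∀ w, w ∈ L v ↔ G.Adj v w

/-- The input word: the number of vertices, and then for each vertex `0, …, n - 1` in turn its
degree followed by the list of its neighbours. -/
def encode {n : ℕ} (L : Fin n → List (Fin n)) : List ℕ :=
  n :: (List.finRange n).flatMap fun v => (L v).length :: (L v).map Fin.val

/-- The initial state: the input is in memory from address `0` on, everything else is `0`. -/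
def initState {n : ℕ} (L : Fin n → List (Fin n)) : State where
  reg _ := 0
  mem i := (encode L).getD i 0

/-- The size of a graph, `|V| + |E| + 1` (the summand `1` only matters for the empty graph). -/
noncomputable def graphSize {n : ℕ} (G : SimpleGraph (Fin n)) : ℕ :=
  n + G.edgeSet.ncard + 1

/-- One fixed program and one constant `c` such that, for every graph `G` of the class `C` and
every adjacency list representation of `G`, the program halts within `c (|V| + |E| + 1)` steps,
using only words of size less than `c (|V| + |E| + 1)` (that is, of `log (|V| + |E|) + O(1)`
bits), with a memory content that is correct for `G` according to `Correct`. -/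
def SolvableInLinearTime (C : ∀ n : ℕ, SimpleGraph (Fin n) → Prop)
    (Correct : ∀ n : ℕ, SimpleGraph (Fin n) → (ℕ → ℕ) → Prop) : Prop :=
  ∃ (p : Program) (c : ℕ), ∀ (n : ℕ) (G : SimpleGraph (Fin n)), C n G →
    ∀ L : Fin n → List (Fin n), IsAdjacencyLists G L →
      ∃ (t : ℕ) (s : State), t ≤ c * graphSize G ∧
        Exec (c * graphSize G) p (initState L) t s ∧ Correct n G s.mem

/-- Correct output for the Maximum `d₂`-Transitivity Problem: cell `0` holds `Tr_{d₂}(G)`, and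
cell `v + 1` holds, for every vertex `v`, the index (counted from `0`) of its part in a
`d₂`-transitive partition of that order. -/
def IsMaxD2TransitivityOutput (n : ℕ) (G : SimpleGraph (Fin n)) (mem : ℕ → ℕ) : Prop :=
  mem 0 = d2Transitivity G ∧
    IsD2TransitivePartition G fun i : Fin (mem 0) => {v : Fin n | mem ((v : ℕ) + 1) = i}

/-- Correct output for the computation of the transitivity: cell `0` holds `Tr(G)`. -/
def IsTransitivityOutput (n : ℕ) (G : SimpleGraph (Fin n)) (mem : ℕ → ℕ) : Prop :=
  mem 0 = transitivity G

end D2Transitivity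

/-!
Call two vertices related if their distance is at most two. In a bipartite chain graph every vertex
that is not isolated is related to all such vertices of its own side, and to exactly its neighbours
on the other side: any two vertices of one side have comparable neighbourhoods, hence a common
neighbour, and vertices of different sides are at odd distance. This gives the second part of the
theorem, and it reduces the first part to the same question as the third one, the largest transitive
partition of two cliques `X` and `Y` with nested neighbourhoods between them (`IsCochain`); isolated
vertices can only be put into the first part.

Let `p = |X|` and `q = |Y|`, and consider a transitive partition of order `k`. At most `q` parts meet
`Y` and at most `p` parts meet `X`. A vertex of largest neighbourhood in each part inside `X` and in
each part inside `Y` gives a clique `A ∪ B` with `|A| ≥ k - q` and `|B| ≥ k - p`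
(`IsCochain.exists_biclique`). Conversely, from such a clique with equalities the partition is
recovered: the clique is cut into singletons, and the `p + q - k` remaining vertices of `X` are
matched with as many of `Y`. A pair dominates all vertices, so the pairs come first
(`IsCochain.isTransitiveFor_label`). As the neighbourhoods are nested, a suitable `A` exists as soon
as `k - q` vertices of `X` have at least `k - p` neighbours in `Y`, and `B` can be taken from the
neighbours of a vertex of `A` of smallest degree.

Both optimal values are therefore determined by numbers of vertices of large degree, and are found
by counting degrees in an array and going down from the largest conceivable `k`. In the complement
of a bipartite chain graph with `n` vertices the condition on `k` is equivalent to the symmetric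
condition that `2 k` is at most `n` plus the number of vertices of degree at least `k - 1`
(`isGreatest_transitivity_of_compl`), so the sides need not be known. In a bipartite chain graph with
an edge, the neighbours of a vertex of maximum degree are taken as `Y`
(`IsBipartiteChain.isCochain_of_degree_le`).

The programs are sequences of passes without nested loops. Each pass is verified with a loop
invariant that also counts the rounds (`runs_loop`).
-/

namespace D2Transitivity

/-! ### Reasoning about programs -/

/-- `Runs W p s Q`: started in `s`, the program `p` halts, and its running time and final state
satisfy `Q`. -/
def Runs (W : ℕ) (p : Program) (s : State) (Q : ℕ → State → Prop) : Prop :=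
  ∃ t s', Exec W p s t s' ∧ Q t s'

/-- Sequential composition. -/
infixr:60 " ;; " => Program.seq

/-- `p.writes r` tells whether `p` contains an assignment to register `r`. -/
def Program.writes : Program → ℕ → Bool
  | .skip, _ => false
  | .assign r' _, r => r' == r
  | .store _ _, _ => false
  | .seq p q, r => p.writes r || q.writes r
  | .branch _ _ p q, r => p.writes r || q.writes r
  | .loop _ _ p, r => p.writes r

/-- Registers that are not assigned keep their values. -/
theorem Exec.reg_eq {W : ℕ} {p : Program} {s s' : State} {t : ℕ} (h : Exec W p s t s') {r : ℕ}
    (hr : p.writes r = false) : s'.reg r = s.reg r := by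
  induction h with
  | skip | store | loop_false => rfl
  | assign r' e s h =>
    have : r ≠ r' := fun h => by simp [Program.writes, h] at hr
    exact Function.update_of_ne this _ _
  | seq _ _ ih₁ ih₂ =>
    simp only [Program.writes, Bool.or_eq_false_iff] at hr
    rw [ih₂ hr.2, ih₁ hr.1]
  | branch_true _ _ _ ih =>
    simp only [Program.writes, Bool.or_eq_false_iff] at hr
    exact ih hr.1
  | branch_false _ _ _ ih =>
    simp only [Program.writes, Bool.or_eq_false_iff] at hr
    exact ih hr.2
  | loop_true _ _ _ ih₁ ih₂ => rw [ih₂ hr, ih₁ hr]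

section Rules

variable {W : ℕ} {s : State} {Q Q' : ℕ → State → Prop}

theorem Runs.mono {p : Program} (h : Runs W p s Q) (hQ : ∀ t s', Q t s' → Q' t s') :
    Runs W p s Q' :=
  let ⟨t, s', he, hq⟩ := h
  ⟨t, s', he, hQ t s' hq⟩

theorem runs_skip : Runs W .skip s Q ↔ Q 1 s :=
  ⟨fun ⟨_, _, he, hq⟩ => by cases he; exact hq, fun h => ⟨1, s, .skip s, h⟩⟩

theorem runs_assign {r : ℕ} {e : Operation} :
    Runs W (.assign r e) s Q ↔
      e.eval s < W ∧ Q 1 { s with reg := Function.update s.reg r (e.eval s) } :=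
  ⟨fun ⟨_, _, he, hq⟩ => by cases he with | assign _ _ _ h => exact ⟨h, hq⟩,
    fun h => ⟨_, _, .assign r e s h.1, h.2⟩⟩

theorem runs_store {a b : ℕ} :
    Runs W (.store a b) s Q ↔
      Q 1 { s with mem := Function.update s.mem (s.reg a) (s.reg b) } :=
  ⟨fun ⟨_, _, he, hq⟩ => by cases he; exact hq, fun h => ⟨_, _, .store a b s, h⟩⟩

theorem runs_seq {p q : Program} :
    Runs W (p ;; q) s Q ↔
      Runs W p s fun t s' => Runs W q s' fun t' s'' => Q (t + t') s'' := by
  constructor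
  · rintro ⟨_, _, he, hq⟩
    cases he with | seq h₁ h₂ => exact ⟨_, _, h₁, _, _, h₂, hq⟩
  · rintro ⟨_, _, h₁, _, _, h₂, hq⟩
    exact ⟨_, _, .seq h₁ h₂, hq⟩

theorem runs_branch {a b : ℕ} {p q : Program} :
    Runs W (.branch a b p q) s Q ↔
      (s.reg a < s.reg b → Runs W p s fun t s' => Q (t + 1) s') ∧
      (¬ s.reg a < s.reg b → Runs W q s fun t s' => Q (t + 1) s') := by
  constructor
  · rintro ⟨_, _, he, hq⟩
    cases he with
    | branch_true _ h hp => exact ⟨fun _ => ⟨_, _, hp, hq⟩, fun h' => absurd h h'⟩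
    | branch_false _ h hp => exact ⟨fun h' => absurd h' h, fun _ => ⟨_, _, hp, hq⟩⟩
  · rintro ⟨h₁, h₂⟩
    by_cases h : s.reg a < s.reg b
    · obtain ⟨_, _, hp, hq⟩ := h₁ h
      exact ⟨_, _, .branch_true q h hp, hq⟩
    · obtain ⟨_, _, hp, hq⟩ := h₂ h
      exact ⟨_, _, .branch_false p h hp, hq⟩

theorem Runs.frame {p : Program} (h : Runs W p s Q) :
    Runs W p s fun t s' => Q t s' ∧ ∀ r, p.writes r = false → s'.reg r = s.reg r :=
  let ⟨t, s', he, hq⟩ := h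
  ⟨t, s', he, hq, fun _ hr => he.reg_eq hr⟩

/-- A loop that keeps the invariant `I` and runs for exactly `N` rounds of at most `T` steps.
That the registers which the body does not write keep their values need not be part of `I`. -/
theorem runs_loop {a b : ℕ} {p : Program} (I : ℕ → State → Prop) (N T : ℕ) (h₀ : I 0 s)
    (hstep : ∀ i < N, ∀ s', (∀ r, p.writes r = false → s'.reg r = s.reg r) → I i s' →
      s'.reg a < s'.reg b ∧ Runs W p s' fun t s'' => t ≤ T ∧ I (i + 1) s'')
    (hend : ∀ s', (∀ r, p.writes r = false → s'.reg r = s.reg r) → I N s' →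
      ¬ s'.reg a < s'.reg b)
    (hQ : ∀ t s', t ≤ N * (T + 1) + 1 → (∀ r, p.writes r = false → s'.reg r = s.reg r) →
      I N s' → Q t s') : Runs W (.loop a b p) s Q := by
  suffices H : ∀ m i s', i + m = N → (∀ r, p.writes r = false → s'.reg r = s.reg r) → I i s' →
      Runs W (.loop a b p) s' fun t s'' => t ≤ m * (T + 1) + 1 ∧
        (∀ r, p.writes r = false → s''.reg r = s.reg r) ∧ I N s'' from
    (H N 0 s (zero_add N) (fun _ _ => rfl) h₀).mono fun t s' h => hQ t s' h.1 h.2.1 h.2.2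
  intro m
  induction m with
  | zero =>
    rintro i s' rfl hf h
    exact ⟨1, s', .loop_false p (hend s' hf h), by omega, hf, h⟩
  | succ m ih =>
    intro i s' hi hf h
    obtain ⟨hlt, t, s₁, he, ht, h'⟩ := hstep i (by omega) s' hf h
    have hf₁ : ∀ r, p.writes r = false → s₁.reg r = s.reg r :=
      fun r hr => (he.reg_eq hr).trans (hf r hr)
    obtain ⟨t', s'', he', ht', h''⟩ := ih (i + 1) s₁ (by omega) hf₁ h'
    exact ⟨_, _, .loop_true hlt he he', by rw [Nat.succ_mul]; omega, h''⟩

end Rules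

/-! ### The input and the memory layout -/

/-- The degree of vertex `i`, as it is found in the input (`0` for `i ≥ n`). -/
def listLength {n : ℕ} (L : Fin n → List (Fin n)) (i : ℕ) : ℕ :=
  if h : i < n then (L ⟨i, h⟩).length else 0

/-- The address of the record of vertex `i` in the input. -/
def offset {n : ℕ} (L : Fin n → List (Fin n)) (i : ℕ) : ℕ :=
  1 + ∑ j ∈ Finset.range i, (listLength L j + 1)

section Input

variable {n : ℕ} (L : Fin n → List (Fin n))

theorem listLength_val (v : Fin n) : listLength L v = (L v).length := by
  simp [listLength]

@[simp] theorem offset_zero : offset L 0 = 1 := by simp [offset]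

theorem offset_succ (i : ℕ) : offset L (i + 1) = offset L i + listLength L i + 1 := by
  simp only [offset, Finset.sum_range_succ]; omega

theorem lt_offset (i : ℕ) : i < offset L i := by
  induction i with
  | zero => simp
  | succ i ih => rw [offset_succ]; omega

theorem offset_mono : Monotone (offset L) :=
  monotone_nat_of_le_succ fun i => by rw [offset_succ]; omega

theorem encode_getD_zero : (encode L).getD 0 0 = n := by simp [encode]

/-- Position `offset L v` of the input starts with the record of `v`. -/
theorem drop_encode (v : Fin n) : ∃ l,
    (encode L).drop (offset L v) = ((L v).length :: (L v).map Fin.val) ++ l := by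
  suffices H : ∀ k (hk : k ≤ n), (encode L).drop (offset L k) =
      ((List.finRange n).drop k).flatMap fun v => (L v).length :: (L v).map Fin.val by
    rw [H v v.2.le, List.drop_eq_getElem_cons (by simp), List.flatMap_cons]
    exact ⟨_, by simp; rfl⟩
  intro k
  induction k with
  | zero => intro _; simp [encode]
  | succ k ih =>
    intro hk
    have h1 : offset L (k + 1) = offset L k + (listLength L k + 1) := by rw [offset_succ]; omega
    rw [h1, ← List.drop_drop, ih (by omega), List.drop_eq_getElem_cons (i := k) (by simpa using hk),
      List.flatMap_cons]
    have h2 : listLength L k + 1 = ((L ⟨k, hk⟩).length :: (L ⟨k, hk⟩).map Fin.val).length := by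
      simp [listLength, Nat.lt_of_succ_le hk]
    rw [h2]
    simp

theorem encode_getD_offset (v : Fin n) : (encode L).getD (offset L v) 0 = listLength L v := by
  obtain ⟨l, hl⟩ := drop_encode L v
  rw [List.getD_eq_getElem?_getD]
  have : (encode L)[offset L v]? = ((encode L).drop (offset L v))[0]? := by simp
  rw [this, hl, listLength_val]
  simp

theorem encode_getD_entry (v : Fin n) {i : ℕ} (hi : i < (L v).length) :
    (encode L).getD (offset L v + 1 + i) 0 = (L v)[i] := by
  obtain ⟨l, hl⟩ := drop_encode L v
  rw [List.getD_eq_getElem?_getD]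
  have : (encode L)[offset L v + 1 + i]? = ((encode L).drop (offset L v))[i + 1]? := by
    rw [List.getElem?_drop]; congr 1; omega
  rw [this, hl, List.cons_append, List.getElem?_cons_succ,
    List.getElem?_append_left (by simpa using hi)]
  simp [hi]

theorem encode_getD_of_le {a : ℕ} (ha : offset L n ≤ a) : (encode L).getD a 0 = 0 := by
  apply List.getD_eq_default
  suffices (encode L).length = offset L n by omega
  have hs : ∑ j ∈ Finset.range n, (listLength L j + 1) = ∑ v : Fin n, ((L v).length + 1) := by
    rw [Finset.sum_range]; simp [listLength_val]
  rw [offset, hs]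
  simp only [encode, List.length_cons, List.length_flatMap, List.length_map]
  rw [← List.ofFn_eq_map, List.sum_ofFn, add_comm]

end Input

/-- The memory during the computation: the input below address `N`, then an array `f` with one
cell for each of the `n` vertices, then an array `g` (extended by zeros). -/
structure Layout (E : ℕ → ℕ) (N n : ℕ) (f g : ℕ → ℕ) (m : ℕ → ℕ) : Prop where
  input : ∀ a < N, m a = E a
  mark : ∀ v < n, m (N + v) = f v
  hist : ∀ j, m (N + n + j) = g j

namespace Layout

variable {E : ℕ → ℕ} {N n : ℕ} {f g m : ℕ → ℕ}

theorem update_mark (h : Layout E N n f g m) {v : ℕ} (hv : v < n) (x : ℕ) :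
    Layout E N n (Function.update f v x) g (Function.update m (N + v) x) where
  input a ha := by rw [Function.update_of_ne (by omega), h.input a ha]
  mark w hw := by
    by_cases hwv : w = v
    · simp [hwv]
    · rw [Function.update_of_ne (by omega), Function.update_of_ne hwv, h.mark w hw]
  hist j := by rw [Function.update_of_ne (by omega), h.hist j]

theorem update_hist (h : Layout E N n f g m) (i x : ℕ) :
    Layout E N n f (Function.update g i x) (Function.update m (N + n + i) x) where
  input a ha := by rw [Function.update_of_ne (by omega), h.input a ha]
  mark w hw := by rw [Function.update_of_ne (by omega), h.mark w hw]
  hist j := by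
    by_cases hji : j = i
    · simp [hji]
    · rw [Function.update_of_ne (by omega), Function.update_of_ne hji, h.hist j]

theorem congr_mark (h : Layout E N n f g m) {f' : ℕ → ℕ} (hf : ∀ v < n, f v = f' v) :
    Layout E N n f' g m :=
  ⟨h.input, fun v hv => (h.mark v hv).trans (hf v hv), h.hist⟩

theorem congr_hist (h : Layout E N n f g m) {g' : ℕ → ℕ} (hg : ∀ j, g j = g' j) :
    Layout E N n f g' m :=
  ⟨h.input, h.mark, fun j => (h.hist j).trans (hg j)⟩

end Layout

/-! ### The passes of the programs

The registers `0`, …, `11` carry values from one pass to the next, as the descriptions of the passes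
say; register `0` always holds `0`. The registers from `16` on are local to the passes, except that
`23` and `24` hold the arguments of `markList`. -/

/-- The first pass. Register `1` receives the constant `1`, register `2` the number of vertices,
register `3` the length of the input, register `4` the address of the second array, register `5`
the number of vertices of positive degree, register `6` the maximum degree, register `7` the
address of the record of a vertex of maximum degree. -/
def readDegrees : Program :=
  .assign 1 (.const 1) ;; .assign 2 (.load 0) ;; .assign 17 (.const 1) ;;
  .loop 16 2 (
    .assign 18 (.load 17) ;;
    .branch 0 18 (.assign 5 (.add 5 1)) .skip ;;
    .branch 6 18 (.assign 6 (.copy 18) ;; .assign 7 (.copy 17)) .skip ;;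
    .assign 17 (.add 17 18) ;; .assign 17 (.add 17 1) ;; .assign 16 (.add 16 1)) ;;
  .assign 3 (.copy 17) ;; .assign 4 (.add 3 2)

/-- Writes register `24` into the cells of the first array that belong to the first vertices of
the list of the record at address register `7`; their number is in register `23`. -/
def markList : Program :=
  .assign 16 (.const 0) ;; .assign 19 (.copy 7) ;;
  .loop 16 23 (
    .assign 19 (.add 19 1) ;; .assign 20 (.load 19) ;; .assign 20 (.add 20 3) ;;
    .store 20 24 ;; .assign 16 (.add 16 1))

/-- Counts, in cell `d + 1` of the second array, the vertices of degree `d` with mark `0`, and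
gives mark `3` to those of degree `0`. -/
def histogram : Program :=
  .assign 16 (.const 0) ;; .assign 17 (.const 1) ;; .assign 25 (.const 3) ;;
  .loop 16 2 (
    .assign 18 (.load 17) ;; .assign 19 (.add 3 16) ;; .assign 20 (.load 19) ;;
    .branch 20 1 (
      .assign 21 (.add 4 18) ;; .assign 21 (.add 21 1) ;; .assign 22 (.load 21) ;;
      .assign 22 (.add 22 1) ;; .store 21 22 ;;
      .branch 0 18 .skip (.store 19 25)) .skip ;;
    .assign 17 (.add 17 18) ;; .assign 17 (.add 17 1) ;; .assign 16 (.add 16 1))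

/-- The contents of registers `0`, …, `4` after the first pass. -/
structure Frame {n : ℕ} (L : Fin n → List (Fin n)) (s : State) : Prop where
  r0 : s.reg 0 = 0
  r1 : s.reg 1 = 1
  r2 : s.reg 2 = n
  r3 : s.reg 3 = offset L n
  r4 : s.reg 4 = offset L n + n

theorem Frame.congr {n : ℕ} {L : Fin n → List (Fin n)} {s s' : State} (h : Frame L s)
    (hs : ∀ r < 5, s'.reg r = s.reg r) : Frame L s' :=
  ⟨by rw [hs 0 (by omega), h.r0], by rw [hs 1 (by omega), h.r1], by rw [hs 2 (by omega), h.r2],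
    by rw [hs 3 (by omega), h.r3], by rw [hs 4 (by omega), h.r4]⟩

/-- The input as a function of the address. -/
def inputMem {n : ℕ} (L : Fin n → List (Fin n)) (a : ℕ) : ℕ := (encode L).getD a 0

section Passes

variable {n W : ℕ} {L : Fin n → List (Fin n)}

theorem initState_mem : (initState L).mem = inputMem L := rfl

theorem inputMem_zero : inputMem L 0 = n := encode_getD_zero L

theorem inputMem_offset {i : ℕ} (hi : i < n) : inputMem L (offset L i) = listLength L i :=
  encode_getD_offset L ⟨i, hi⟩

theorem layout_initState :
    Layout (inputMem L) (offset L n) n (fun _ => 0) (fun _ => 0) (inputMem L) :=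
  ⟨fun _ _ => rfl, fun _ _ => encode_getD_of_le L (by omega),
    fun _ => encode_getD_of_le L (by omega)⟩

theorem card_filter_range_le (i : ℕ) (p : ℕ → Prop) [DecidablePred p] :
    ((Finset.range i).filter p).card ≤ i := by
  simpa using Finset.card_filter_le (Finset.range i) p

theorem card_filter_range_succ (i : ℕ) (p : ℕ → Prop) [DecidablePred p] :
    ((Finset.range (i + 1)).filter p).card =
      ((Finset.range i).filter p).card + if p i then 1 else 0 := by
  rw [Finset.range_add_one, Finset.filter_insert]
  split_ifs <;> simp

theorem offset_add_listLength_lt {i : ℕ} (hi : i < n) :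
    offset L i + listLength L i < offset L n := by
  have := offset_mono L (show i + 1 ≤ n from hi)
  rw [offset_succ] at this
  omega

theorem runs_readDegrees (hW : 5 * offset L n + 10 ≤ W) :
    Runs W readDegrees (initState L) fun t s => t ≤ 30 * (n + 1) ∧ Frame L s ∧
      s.reg 5 = ((Finset.range n).filter fun i => 0 < listLength L i).card ∧
      (∀ i < n, listLength L i ≤ s.reg 6) ∧
      (s.reg 6 = 0 ∨ ∃ u < n, listLength L u = s.reg 6 ∧ s.reg 7 = offset L u) ∧
      Layout (inputMem L) (offset L n) n (fun _ => 0) (fun _ => 0) s.mem := by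
  have hn := lt_offset L n
  have hr0 : ∀ r, (initState L).reg r = 0 := fun _ => rfl
  simp only [readDegrees, runs_seq, runs_assign, Operation.eval, initState_mem]
  refine ⟨by omega, by simp [hr0, inputMem_zero]; omega, by omega, ?_⟩
  refine runs_loop (fun i s => s.reg 16 = i ∧ s.reg 17 = offset L i ∧
      s.reg 5 = ((Finset.range i).filter fun i => 0 < listLength L i).card ∧
      (∀ j < i, listLength L j ≤ s.reg 6) ∧
      (s.reg 6 = 0 ∨ ∃ u < i, listLength L u = s.reg 6 ∧ s.reg 7 = offset L u) ∧
      s.mem = inputMem L) n 15 ?_ ?_ ?_ ?_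
  · simp [hr0]
  · rintro i hi s hf ⟨h16, h17, h5, h6, h7, hm⟩
    have h0 : s.reg 0 = 0 := by simp [hf 0 rfl, hr0]
    have h1 : s.reg 1 = 1 := by simp [hf 1 rfl]
    have h2 : s.reg 2 = n := by simp [hf 2 rfl, hr0, inputMem_zero]
    refine ⟨by omega, ?_⟩
    have hd := offset_add_listLength_lt (L := L) hi
    have hcard := card_filter_range_le i fun i => 0 < listLength L i
    have hl := inputMem_offset (L := L) hi
    have hs := card_filter_range_succ i fun i => 0 < listLength L i
    simp only [runs_seq, runs_assign, runs_branch, runs_skip, Operation.eval]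
    by_cases hpos : 0 < listLength L i <;> by_cases hmax : s.reg 6 < listLength L i <;>
      simp [h0, h1, h16, h17, h5, hm, hl, offset_succ, hpos, hmax, hs]
    all_goals
      constructorm* _ ∧ _
      all_goals first
        | omega
        | exact Or.inr ⟨i, le_rfl, rfl, rfl⟩
        | exact h7.imp id fun ⟨u, hu, h⟩ => ⟨u, hu.le, h⟩
        | intro j hj
          rcases hj.lt_or_eq with hj | rfl
          · have := h6 j hj
            omega
          · omega
  · rintro s hf ⟨h16, -⟩
    simp [h16, hf 2 rfl, hr0, inputMem_zero]
  · rintro t s ht hf ⟨h16, h17, h5, h6, h7, hm⟩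
    have h0 : s.reg 0 = 0 := by simp [hf 0 rfl, hr0]
    have h1 : s.reg 1 = 1 := by simp [hf 1 rfl]
    have h2 : s.reg 2 = n := by simp [hf 2 rfl, hr0, inputMem_zero]
    refine ⟨by simp [h17]; omega, by simp [h17, h2]; omega, by omega, ⟨?_, ?_, ?_, ?_, ?_⟩, ?_⟩
    all_goals simp [*]
    exact ⟨h6, layout_initState⟩

theorem runs_markList (hW : 5 * offset L n + 10 ≤ W) {s : State} (hs : Frame L s)
    {f g : ℕ → ℕ} (hm : Layout (inputMem L) (offset L n) n f g s.mem) (l : List ℕ)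
    (hl : s.reg 23 = l.length) (hln : ∀ w ∈ l, w < n)
    (hin : ∀ i (hi : i < l.length), s.reg 7 + 1 + i < offset L n ∧
      inputMem L (s.reg 7 + 1 + i) = l[i]) (h7 : s.reg 7 < offset L n) :
    Runs W markList s fun t s' => t ≤ 10 * (l.length + 1) ∧
      Layout (inputMem L) (offset L n) n (fun w => if w ∈ l then s.reg 24 else f w) g s'.mem := by
  have hn := lt_offset L n
  simp only [markList, runs_seq, runs_assign, Operation.eval]
  refine ⟨by omega, by simp; omega, ?_⟩
  refine runs_loop (fun i s' => s'.reg 16 = i ∧ s'.reg 19 = s.reg 7 + i ∧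
      Layout (inputMem L) (offset L n) n (fun w => if w ∈ l.take i then s.reg 24 else f w) g
        s'.mem) l.length 7 ?_ ?_ ?_ ?_
  · simpa using hm
  · rintro i hi s' hf ⟨h16, h19, hm'⟩
    have h1 : s'.reg 1 = 1 := by simp [hf 1 rfl, hs.r1]
    have h3 : s'.reg 3 = offset L n := by simp [hf 3 rfl, hs.r3]
    have h23 : s'.reg 23 = l.length := by simp [hf 23 rfl, hl]
    have h24 : s'.reg 24 = s.reg 24 := by simp [hf 24 rfl]
    refine ⟨by omega, ?_⟩
    obtain ⟨ha, hv⟩ := hin i hi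
    have hv' : s'.mem (s.reg 7 + i + 1) = l[i] := by
      rw [← hv, ← hm'.input _ ha]; congr 1; omega
    have hw := hln _ (List.getElem_mem hi)
    have hm'' := (hm'.update_mark hw (s.reg 24)).congr_mark
      (f' := fun w => if w ∈ l.take (i + 1) then s.reg 24 else f w) fun w _ => by
        simp only [Function.update_apply, List.take_add_one, List.getElem?_eq_getElem hi,
          Option.toList_some, List.mem_append, List.mem_singleton]
        split_ifs <;> simp_all
    simp only [runs_seq, runs_assign, runs_store, Operation.eval]
    simp [h1, h3, h16, h19, h24, hv', add_comm l[i]]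
    exact ⟨by omega, by omega, by omega, by omega, by omega, hm''⟩
  · rintro s' hf ⟨h16, -⟩
    simp [h16, hf 23 rfl, hl]
  · rintro t s' ht hf ⟨-, -, hm'⟩
    refine ⟨by omega, by simpa using hm'⟩

theorem runs_histogram (hW : 5 * offset L n + 10 ≤ W) {s : State} (hs : Frame L s)
    {f : ℕ → ℕ} (hm : Layout (inputMem L) (offset L n) n f (fun _ => 0) s.mem)
    (hf3 : ∀ v < n, f v ≤ 3) :
    Runs W histogram s fun t s' => t ≤ 30 * (n + 1) ∧
      Layout (inputMem L) (offset L n) n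
        (fun w => if f w = 0 ∧ listLength L w = 0 then 3 else f w)
        (fun j => ((Finset.range n).filter fun w => f w = 0 ∧ listLength L w + 1 = j).card)
        s'.mem := by
  have hn := lt_offset L n
  simp only [histogram, runs_seq, runs_assign, Operation.eval]
  refine ⟨by omega, by omega, by omega, ?_⟩
  refine runs_loop (fun i s' => s'.reg 16 = i ∧ s'.reg 17 = offset L i ∧
      Layout (inputMem L) (offset L n) n
        (fun w => if w < i ∧ f w = 0 ∧ listLength L w = 0 then 3 else f w)
        (fun j => ((Finset.range i).filter fun w => f w = 0 ∧ listLength L w + 1 = j).card)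
        s'.mem) n 20 ?_ ?_ ?_ ?_
  · simpa using hm
  · rintro i hi s' hf ⟨h16, h17, hm'⟩
    have h0 : s'.reg 0 = 0 := by simp [hf 0 rfl, hs.r0]
    have h1 : s'.reg 1 = 1 := by simp [hf 1 rfl, hs.r1]
    have h2 : s'.reg 2 = n := by simp [hf 2 rfl, hs.r2]
    have h3 : s'.reg 3 = offset L n := by simp [hf 3 rfl, hs.r3]
    have h4 : s'.reg 4 = offset L n + n := by simp [hf 4 rfl, hs.r4]
    have h25 : s'.reg 25 = 3 := by simp [hf 25 rfl]
    refine ⟨by omega, ?_⟩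
    have hd := offset_add_listLength_lt (L := L) hi
    have hl : s'.mem (offset L i) = listLength L i := by
      rw [hm'.input _ (by omega), inputMem_offset hi]
    have hfi : s'.mem (offset L n + i) = f i := by simp [hm'.mark i hi]
    have hfi3 := hf3 i hi
    have hcard := card_filter_range_le i fun w => f w = 0 ∧ listLength L w = listLength L i
    have hhist : s'.mem (offset L n + n + listLength L i + 1) =
        ((Finset.range i).filter fun w => f w = 0 ∧ listLength L w = listLength L i).card := by
      simpa [add_assoc] using hm'.hist (listLength L i + 1)
    have hg := fun j => card_filter_range_succ i fun w => f w = 0 ∧ listLength L w + 1 = j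
    have hupd : f i = 0 → Layout (inputMem L) (offset L n) n
        (fun w => if w < i ∧ f w = 0 ∧ listLength L w = 0 then 3 else f w)
        (fun j => ((Finset.range (i + 1)).filter fun w => f w = 0 ∧ listLength L w + 1 = j).card)
        (Function.update s'.mem (offset L n + n + listLength L i + 1)
          (s'.mem (offset L n + n + listLength L i + 1) + 1)) := fun h =>
      (hm'.update_hist (listLength L i + 1) _).congr_hist fun j => by
        rw [hg, hhist, Function.update_apply]
        by_cases hj : j = listLength L i + 1 <;> simp [hj, h, eq_comm]
    rw [hhist] at hupd
    simp only [runs_seq, runs_assign, runs_branch, runs_store, runs_skip, Operation.eval]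
    by_cases hpos : 0 < listLength L i <;> by_cases hmark : f i = 0 <;>
      simp [h0, h1, h3, h4, h16, h17, hl, hfi, h25, offset_succ, hpos, hmark, hhist]
    all_goals refine ⟨by omega, by omega, by omega, by omega, by omega, by omega, ?_⟩
    · refine ⟨by omega, by omega, by omega, by omega, (hupd hmark).congr_mark fun w _ => ?_⟩
      rcases lt_trichotomy w i with h | rfl | h <;> grind
    · refine (hm'.congr_mark fun w _ => ?_).congr_hist fun j => ?_
      · rcases lt_trichotomy w i with h | rfl | h <;> grind
      · simp [hg, hmark]
    · refine ⟨by omega, by omega, by omega, by omega,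
        ((hupd hmark).update_mark hi 3).congr_mark fun w _ => ?_⟩
      rw [Function.update_apply]
      rcases lt_trichotomy w i with h | rfl | h <;> grind
    · refine (hm'.congr_mark fun w _ => ?_).congr_hist fun j => ?_
      · rcases lt_trichotomy w i with h | rfl | h <;> grind
      · simp [hg, hmark]
  · rintro s' hf ⟨h16, -⟩
    simp [h16, hf 2 rfl, hs.r2]
  · rintro t s' ht hf ⟨-, -, hm'⟩
    refine ⟨by omega, hm'.congr_mark fun w hw => by simp [hw]⟩

end Passes

/-- Puts into register `8` the largest `k` such that `2 k` is at most `n` plus the number of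
vertices of degree at least `k - 1`, by going down from `k = n + 1`. Register `22` holds the
current number of vertices, which the second array provides. -/
def searchTransitivity : Program :=
  .assign 8 (.add 2 1) ;; .assign 22 (.const 0) ;; .assign 23 (.copy 2) ;; .assign 24 (.add 8 8) ;;
  .loop 23 24 (
    .assign 8 (.sub 8 1) ;; .assign 20 (.add 4 8) ;; .assign 21 (.load 20) ;;
    .assign 22 (.add 22 21) ;; .assign 23 (.add 22 2) ;; .assign 24 (.add 8 8))

/-- With `q` in register `6` and `p + q` in register `5`, puts into register `8` the largest `k`
such that `k` is at most `q` plus the number of vertices of mark `0` and degree at least `k - p`,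
and `k - p` into register `9`. -/
def searchD2 : Program :=
  .assign 8 (.add 5 1) ;; .assign 9 (.add 6 1) ;; .assign 26 (.const 0) ;; .assign 27 (.copy 6) ;;
  .loop 27 8 (
    .assign 8 (.sub 8 1) ;; .assign 9 (.sub 9 1) ;; .assign 19 (.add 4 9) ;;
    .assign 19 (.add 19 1) ;; .assign 20 (.load 19) ;; .assign 26 (.add 26 20) ;;
    .assign 27 (.add 26 6))

/-- Gives mark `2` to as many vertices of mark `0` and degree at least register `9` as the
difference of the registers `8` and `6` says, and moves register `7` to the record of one of them
of smallest degree. -/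
def select : Program :=
  .assign 16 (.const 0) ;; .assign 17 (.const 1) ;; .assign 10 (.sub 8 6) ;;
  .assign 11 (.copy 6) ;; .assign 24 (.const 2) ;;
  .loop 16 2 (
    .assign 18 (.load 17) ;; .assign 19 (.add 3 16) ;; .assign 20 (.load 19) ;;
    .branch 20 1 (.branch 0 10 (.branch 18 9 .skip (
      .store 19 24 ;; .assign 10 (.sub 10 1) ;;
      .branch 18 11 (.assign 11 (.copy 18) ;; .assign 7 (.copy 17)) .skip)) .skip) .skip ;;
    .assign 17 (.add 17 18) ;; .assign 17 (.add 17 1) ;; .assign 16 (.add 16 1))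

/-- Writes the labels of the vertices, see `label`, over the input. -/
def writeLabels : Program :=
  .assign 16 (.const 0) ;; .assign 28 (.const 0) ;; .assign 29 (.const 0) ;;
  .assign 30 (.sub 5 8) ;; .assign 24 (.const 2) ;; .assign 25 (.const 3) ;;
  .loop 16 2 (
    .assign 19 (.add 3 16) ;; .assign 20 (.load 19) ;; .assign 16 (.add 16 1) ;;
    .branch 20 1 (.store 16 28 ;; .assign 28 (.add 28 1))
      (.branch 20 24 (.store 16 29 ;; .assign 29 (.add 29 1))
        (.branch 20 25 (.store 16 30 ;; .assign 30 (.add 30 1)) (.store 16 0))))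

/-- The label of vertex `v` in terms of the marks `f`: the vertices of mark `0` are numbered from
`0` on, those of mark `1` as well, those of mark `2` from `c` on, and the remaining vertices
receive the label `0`. -/
def label (f : ℕ → ℕ) (c v : ℕ) : ℕ :=
  if f v ≤ 1 then ((Finset.range v).filter fun w => f w = f v).card
  else if f v = 2 then c + ((Finset.range v).filter fun w => f w = f v).card
  else 0

theorem card_filter_le_eq_add {n : ℕ} (p : ℕ → Prop) [DecidablePred p] (d : ℕ → ℕ) (k : ℕ) :
    ((Finset.range n).filter fun w => p w ∧ k ≤ d w).card =
      ((Finset.range n).filter fun w => p w ∧ k + 1 ≤ d w).card +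
        ((Finset.range n).filter fun w => p w ∧ d w = k).card := by
  rw [← Finset.card_union_of_disjoint, ← Finset.filter_or]
  · congr 1
    ext w
    simp only [Finset.mem_filter]
    grind
  · rw [Finset.disjoint_filter]
    omega

section Passes

variable {n W : ℕ} {L : Fin n → List (Fin n)}

theorem runs_searchTransitivity (hW : 5 * offset L n + 10 ≤ W) {s : State} (hs : Frame L s)
    {f : ℕ → ℕ} (hm : Layout (inputMem L) (offset L n) n f
      (fun j => ((Finset.range n).filter fun w => True ∧ listLength L w + 1 = j).card) s.mem)
    (hd : ∀ i < n, listLength L i < n) {k : ℕ}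
    (hk : IsGreatest {k | 2 * k ≤
      n + ((Finset.range n).filter fun w => True ∧ k ≤ listLength L w + 1).card} k) :
    Runs W searchTransitivity s fun t s' => t ≤ 20 * (n + 1) ∧ s'.reg 8 = k := by
  have hn := lt_offset L n
  have hkn : k ≤ n := by
    have h1 := hk.1
    have h2 := card_filter_range_le n fun w => True ∧ k ≤ listLength L w + 1
    rw [Set.mem_ofPred_eq] at h1
    omega
  set c := fun k => ((Finset.range n).filter fun w => True ∧ k ≤ listLength L w + 1).card with hc
  have hcn : ∀ k, c k ≤ n := fun k => card_filter_range_le n _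
  simp only [searchTransitivity, runs_seq, runs_assign, Operation.eval]
  refine ⟨by simp [hs.r1, hs.r2]; omega, by omega, by simp [hs.r2]; omega,
    by simp [hs.r1, hs.r2]; omega, ?_⟩
  -- after `i` rounds the candidate is `n + 1 - i`, so the largest admissible `k` ends the loop
  refine runs_loop (fun i s' => s'.reg 8 = n + 1 - i ∧ s'.reg 22 = c (n + 1 - i) ∧
      s'.reg 23 = c (n + 1 - i) + n ∧ s'.reg 24 = 2 * (n + 1 - i) ∧ s'.mem = s.mem)
      (n + 1 - k) 8 ?_ ?_ ?_ ?_
  · have h0 : c (n + 1) = 0 := by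
      simp only [hc, Finset.card_eq_zero, Finset.filter_eq_empty_iff, Finset.mem_range]
      intro w hw
      have := hd w hw
      omega
    simp [hs.r1, hs.r2, h0]
    omega
  · rintro i hi s' hf ⟨h8, h22, h23, h24, hm'⟩
    have h1 : s'.reg 1 = 1 := by simp [hf 1 rfl, hs.r1]
    have h2 : s'.reg 2 = n := by simp [hf 2 rfl, hs.r2]
    have h4 : s'.reg 4 = offset L n + n := by simp [hf 4 rfl, hs.r4]
    have hlt : ¬ 2 * (n + 1 - i) ≤ n + c (n + 1 - i) := fun h => by
      have := hk.2 h
      omega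
    refine ⟨by omega, ?_⟩
    have hsplit := card_filter_le_eq_add (n := n) (fun _ => True) (fun w => listLength L w + 1)
      (n - i)
    rw [← hm.hist, show n - i + 1 = n + 1 - i by omega] at hsplit
    change c (n - i) = c (n + 1 - i) + _ at hsplit
    have e1 : n + 1 - i - 1 = n - i := by omega
    have e2 : n + 1 - (i + 1) = n - i := by omega
    have := hcn (n - i)
    simp only [runs_seq, runs_assign, Operation.eval]
    simp [h1, h2, h4, h8, h22, hm', ← hsplit, e1]
    omega
  · rintro s' hf ⟨h8, h22, h23, h24, hm'⟩
    have := hk.1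
    rw [h23, h24, show n + 1 - (n + 1 - k) = k by omega]
    change 2 * k ≤ n + c k at this
    omega
  · rintro t s' ht hf ⟨h8, -⟩
    exact ⟨by omega, by omega⟩

theorem runs_searchD2 (hW : 5 * offset L n + 10 ≤ W) {s : State} (hs : Frame L s)
    {f f' : ℕ → ℕ} (hm : Layout (inputMem L) (offset L n) n f'
      (fun j => ((Finset.range n).filter fun w => f w = 0 ∧ listLength L w + 1 = j).card) s.mem)
    {p q : ℕ} (h5 : s.reg 5 = p + q) (h6 : s.reg 6 = q) (hpq : p + q ≤ n)
    (hd : ∀ i < n, listLength L i ≤ q) {k : ℕ} (hpk : p ≤ k)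
    (hk : IsGreatest {k | k ≤
      q + ((Finset.range n).filter fun w => f w = 0 ∧ k - p ≤ listLength L w).card} k)
    (hkpq : k ≤ p + q) :
    Runs W searchD2 s fun t s' => t ≤ 20 * (n + 1) ∧ s'.reg 8 = k ∧ s'.reg 9 = k - p ∧
      s'.mem = s.mem := by
  have hn := lt_offset L n
  set c := fun j => ((Finset.range n).filter fun w => f w = 0 ∧ j ≤ listLength L w).card with hc
  have hcn : ∀ k, c k ≤ n := fun k => card_filter_range_le n _
  simp only [searchD2, runs_seq, runs_assign, Operation.eval]
  refine ⟨by simp [hs.r1, h5]; omega, by simp [hs.r1, h6]; omega, by omega,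
    by simp [h6]; omega, ?_⟩
  -- the degree threshold `k - p` of the candidate `k = p + q + 1 - i` is `q + 1 - i`
  refine runs_loop (fun i s' => s'.reg 8 = p + q + 1 - i ∧ s'.reg 9 = q + 1 - i ∧
      s'.reg 26 = c (q + 1 - i) ∧ s'.reg 27 = c (q + 1 - i) + q ∧ s'.mem = s.mem)
      (p + q + 1 - k) 8 ?_ ?_ ?_ ?_
  · have h0 : c (q + 1) = 0 := by
      simp only [hc, Finset.card_eq_zero, Finset.filter_eq_empty_iff, Finset.mem_range]
      intro w hw
      have := hd w hw
      omega
    simp [hs.r1, h5, h6, h0]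
  · rintro i hi s' hf ⟨h8, h9, h26, h27, hm'⟩
    have h1 : s'.reg 1 = 1 := by simp [hf 1 rfl, hs.r1]
    have h4 : s'.reg 4 = offset L n + n := by simp [hf 4 rfl, hs.r4]
    have h6' : s'.reg 6 = q := by simp [hf 6 rfl, h6]
    have hlt : ¬ p + q + 1 - i ≤ q + c (p + q + 1 - i - p) := fun h => by
      have := hk.2 h
      omega
    rw [show p + q + 1 - i - p = q + 1 - i by omega] at hlt
    refine ⟨by omega, ?_⟩
    have hsplit := card_filter_le_eq_add (n := n) (fun w => f w = 0) (fun w => listLength L w)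
      (q - i)
    have hh := hm.hist (q - i + 1)
    simp only [add_left_inj, ← add_assoc] at hh
    rw [← hh, show q - i + 1 = q + 1 - i by omega] at hsplit
    change c (q - i) = c (q + 1 - i) + _ at hsplit
    have e1 : q + 1 - i - 1 = q - i := by omega
    have e2 : q + 1 - (i + 1) = q - i := by omega
    have := hcn (q - i)
    simp only [runs_seq, runs_assign, Operation.eval]
    simp [h1, h4, h6', h8, h9, h26, hm', ← hsplit, e1]
    omega
  · rintro s' hf ⟨h8, h9, h26, h27, hm'⟩
    have := hk.1
    rw [h27, h8, show q + 1 - (p + q + 1 - k) = k - p by omega]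
    change k ≤ q + c (k - p) at this
    omega
  · rintro t s' ht hf ⟨h8, h9, -, -, hm'⟩
    refine ⟨by omega, by omega, by omega, hm'⟩

theorem runs_select (hW : 5 * offset L n + 10 ≤ W) {s : State} (hs : Frame L s)
    {f g : ℕ → ℕ} (hm : Layout (inputMem L) (offset L n) n f g s.mem) (hf3 : ∀ v < n, f v ≤ 3)
    {q k j u : ℕ} (h6 : s.reg 6 = q) (h8 : s.reg 8 = k) (h9 : s.reg 9 = j) (hu : u < n)
    (hqu : listLength L u = q) (h7 : s.reg 7 = offset L u) (hkn : k ≤ n)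
    (hcard : k - q ≤ ((Finset.range n).filter fun w => f w = 0 ∧ j ≤ listLength L w).card) :
    Runs W select s fun t s' => t ≤ 30 * (n + 1) ∧ ∃ A : Finset ℕ, A.card = k - q ∧
      (∀ w ∈ A, w < n ∧ f w = 0 ∧ j ≤ listLength L w) ∧
      Layout (inputMem L) (offset L n) n (fun w => if w ∈ A then 2 else f w) g s'.mem ∧
      ∃ v, s'.reg 7 = offset L v ∧ (v = u ∨ v ∈ A) ∧ ∀ w ∈ A, listLength L v ≤ listLength L w := by
  have hn := lt_offset L n
  have hqN := offset_add_listLength_lt (L := L) hu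
  simp only [select, runs_seq, runs_assign, Operation.eval]
  refine ⟨by omega, by omega, by simp [h6, h8]; omega, by simp [h6]; omega, by omega, ?_⟩
  -- `A` is the set selected so far; unless it is already complete, it contains all candidates
  refine runs_loop (fun i s' => s'.reg 16 = i ∧ s'.reg 17 = offset L i ∧ ∃ A : Finset ℕ,
      A.card + s'.reg 10 = k - q ∧ (∀ w ∈ A, w < i ∧ f w = 0 ∧ j ≤ listLength L w) ∧
      (s'.reg 10 = 0 ∨
        ((Finset.range i).filter fun w => f w = 0 ∧ j ≤ listLength L w).card ≤ A.card) ∧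
      Layout (inputMem L) (offset L n) n (fun w => if w ∈ A then 2 else f w) g s'.mem ∧
      ∃ v, s'.reg 7 = offset L v ∧ s'.reg 11 = listLength L v ∧
        (v = u ∨ v ∈ A) ∧ ∀ w ∈ A, listLength L v ≤ listLength L w) n 20 ?_ ?_ ?_ ?_
  · refine ⟨by simp, by simp, ∅, ?_⟩
    simp [h6, h7, h8, hqu]
    exact hm
  · rintro i hi s' hf ⟨h16, h17, A, hA, hAf, hA', hm', v, h7', h11, hv, hvA⟩
    have h0 : s'.reg 0 = 0 := by simp [hf 0 rfl, hs.r0]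
    have h1 : s'.reg 1 = 1 := by simp [hf 1 rfl, hs.r1]
    have h2 : s'.reg 2 = n := by simp [hf 2 rfl, hs.r2]
    have h3 : s'.reg 3 = offset L n := by simp [hf 3 rfl, hs.r3]
    have h9' : s'.reg 9 = j := by simp [hf 9 rfl, h9]
    have h24 : s'.reg 24 = 2 := by simp [hf 24 rfl]
    refine ⟨by omega, ?_⟩
    have hd := offset_add_listLength_lt (L := L) hi
    have hl : s'.mem (offset L i) = listLength L i := by
      rw [hm'.input _ (by omega), inputMem_offset hi]
    have hiA : i ∉ A := fun h => by have := (hAf i h).1; omega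
    have hfi : s'.mem (offset L n + i) = f i := by simp [hm'.mark i hi, hiA]
    have hfi3 := hf3 i hi
    have hc := card_filter_range_succ i fun w => f w = 0 ∧ j ≤ listLength L w
    have hAf' : ∀ w ∈ A, w < i + 1 ∧ f w = 0 ∧ j ≤ listLength L w := fun w hw =>
      ⟨by have := (hAf w hw).1; omega, (hAf w hw).2⟩
    simp only [runs_seq, runs_assign, runs_branch, runs_store, runs_skip, Operation.eval]
    by_cases hmark : f i = 0 ∧ 0 < s'.reg 10 ∧ j ≤ listLength L i
    · obtain ⟨hmark, hr, hj⟩ := hmark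
      have hAi : ∀ w ∈ insert i A, w < i + 1 ∧ f w = 0 ∧ j ≤ listLength L w := by
        intro w hw
        rcases Finset.mem_insert.1 hw with rfl | hw
        · exact ⟨by omega, hmark, hj⟩
        · exact hAf' w hw
      have hmi := (hm'.update_mark hi 2).congr_mark
        (f' := fun w => if w ∈ insert i A then 2 else f w) fun w _ => by
          rw [Function.update_apply]
          by_cases h : w = i <;> simp [h]
      have hA1 : (insert i A).card = A.card + 1 := Finset.card_insert_of_notMem hiA
      have hA'' : s'.reg 10 - 1 = 0 ∨ ((Finset.range (i + 1)).filter fun w =>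
          f w = 0 ∧ j ≤ listLength L w).card ≤ (insert i A).card := by
        rw [hc, hA1]
        split_ifs <;> omega
      by_cases hmin : listLength L i < s'.reg 11
      · simp [h0, h1, h3, h9', h16, h17, hl, hfi, h24, offset_succ, hmin, hmark, hr, hj]
        refine ⟨by omega, by omega, by omega, by omega, by omega, by omega, by omega, by omega,
          by omega, insert i A, by omega, fun w hw => ?_, hA'', hmi, i, rfl, rfl, by simp, ?_⟩
        · simpa [Nat.lt_succ_iff] using hAi w hw
        · intro w hw
          rcases Finset.mem_insert.1 hw with rfl | hw
          · exact le_rfl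
          · have := hvA w hw
            omega
      · simp [h0, h1, h3, h9', h16, h17, hl, hfi, h24, offset_succ, hmin, hmark, hr, hj]
        refine ⟨by omega, by omega, by omega, by omega, by omega, by omega, by omega,
          insert i A, by omega, fun w hw => ?_, hA'', hmi, v, h7', h11, ?_, ?_⟩
        · simpa [Nat.lt_succ_iff] using hAi w hw
        · exact hv.imp_right Finset.mem_insert_of_mem
        · intro w hw
          rcases Finset.mem_insert.1 hw with rfl | hw
          · omega
          · exact hvA w hw
    · have hA'' : s'.reg 10 = 0 ∨ ((Finset.range (i + 1)).filter fun w =>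
          f w = 0 ∧ j ≤ listLength L w).card ≤ A.card := by
        rw [hc]
        split_ifs <;> omega
      simp only [Nat.lt_succ_iff] at hAf'
      by_cases h0' : f i = 0
      · by_cases hr : 0 < s'.reg 10
        · have hj : listLength L i < j := by
            by_contra hj
            exact hmark ⟨h0', hr, by omega⟩
          simp [h0, h1, h3, h9', h16, h17, hl, hfi, offset_succ, h0', hr, hj]
          exact ⟨by omega, by omega, by omega, by omega, by omega, by omega,
            A, hA, hAf', hA'', hm', v, h7', h11, hv, hvA⟩
        · simp [h0, h1, h3, h16, h17, hl, hfi, offset_succ, h0', hr]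
          exact ⟨by omega, by omega, by omega, by omega, by omega, by omega,
            A, hA, hAf', hA'', hm', v, h7', h11, hv, hvA⟩
      · simp [h1, h3, h16, h17, hl, hfi, offset_succ, h0']
        exact ⟨by omega, by omega, by omega, by omega, by omega, by omega,
          A, hA, hAf', hA'', hm', v, h7', h11, hv, hvA⟩
  · rintro s' hf ⟨h16, -⟩
    simp [h16, hf 2 rfl, hs.r2]
  · rintro t s' ht hf ⟨h16, h17, A, hA, hAf, hA', hm', v, h7', h11, hv, hvA⟩
    exact ⟨by omega, A, by omega, hAf, hm', v, h7', hv, hvA⟩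

theorem runs_writeLabels (hW : 5 * offset L n + 10 ≤ W) {s : State} (hs : Frame L s)
    {f g : ℕ → ℕ} (hm : Layout (inputMem L) (offset L n) n f g s.mem) (hf3 : ∀ v < n, f v ≤ 3)
    (h5 : s.reg 5 ≤ n) :
    Runs W writeLabels s fun t s' => t ≤ 30 * (n + 1) ∧
      ∀ v < n, s'.mem (v + 1) = label f (s.reg 5 - s.reg 8) v := by
  have hn := lt_offset L n
  set c := s.reg 5 - s.reg 8 with hc
  simp only [writeLabels, runs_seq, runs_assign, Operation.eval]
  refine ⟨by omega, by omega, by omega, by simp; omega, by omega, by omega, ?_⟩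
  refine runs_loop (fun i s' => s'.reg 16 = i ∧
      s'.reg 28 = ((Finset.range i).filter fun w => f w = 0).card ∧
      s'.reg 29 = ((Finset.range i).filter fun w => f w = 1).card ∧
      s'.reg 30 = c + ((Finset.range i).filter fun w => f w = 2).card ∧
      (∀ v < n, s'.mem (offset L n + v) = f v) ∧
      ∀ v < i, s'.mem (v + 1) = label f c v) n 20 ?_ ?_ ?_ ?_
  · simp [hc]
    exact hm.mark
  · rintro i hi s' hf ⟨h16, h28, h29, h30, hm', hlab⟩
    have h0 : s'.reg 0 = 0 := by simp [hf 0 rfl, hs.r0]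
    have h1 : s'.reg 1 = 1 := by simp [hf 1 rfl, hs.r1]
    have h2 : s'.reg 2 = n := by simp [hf 2 rfl, hs.r2]
    have h3 : s'.reg 3 = offset L n := by simp [hf 3 rfl, hs.r3]
    have h24 : s'.reg 24 = 2 := by simp [hf 24 rfl]
    have h25 : s'.reg 25 = 3 := by simp [hf 25 rfl]
    refine ⟨by omega, ?_⟩
    have hfi := hm' i hi
    have hfi3 := hf3 i hi
    have hs := fun x => card_filter_range_succ i fun w => f w = x
    have hci := fun x => card_filter_range_le i fun w => f w = x
    have hc0 := hci 0
    have hc1 := hci 1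
    have hc2 := hci 2
    -- writing the label of `i` changes neither the marks nor the earlier labels
    have hm'' : ∀ x, ∀ v < n, Function.update s'.mem (i + 1) x (offset L n + v) = f v :=
      fun x v hv => by rw [Function.update_of_ne (by omega), hm' v hv]
    have hlab' : ∀ x, label f c i = x →
        ∀ v ≤ i, Function.update s'.mem (i + 1) x (v + 1) = label f c v := fun x hx v hv => by
      rcases hv.lt_or_eq with hv | rfl
      · rw [Function.update_of_ne (by omega), hlab v hv]
      · rw [hx, Function.update_self]
    simp only [runs_seq, runs_assign, runs_branch, runs_store, Operation.eval]
    have h4 : f i = 0 ∨ f i = 1 ∨ f i = 2 ∨ f i = 3 := by omega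
    rcases h4 with h | h | h | h <;>
      simp [h0, h1, h3, h16, h24, h25, hfi, h, hs, h28, h29, h30]
    · exact ⟨by omega, by omega, by omega, by omega, hm'' _, hlab' _ (by simp [label, h])⟩
    · exact ⟨by omega, by omega, by omega, by omega, hm'' _, hlab' _ (by simp [label, h])⟩
    · exact ⟨by omega, by omega, by omega, by omega, by omega, hm'' _,
        hlab' _ (by simp [label, h])⟩
    · exact ⟨by omega, by omega, by omega, hm'' _, hlab' _ (by simp [label, h])⟩
  · rintro s' hf ⟨h16, -⟩
    simp [h16, hf 2 rfl, hs.r2]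
  · rintro t s' ht hf ⟨-, -, -, -, -, hlab⟩
    exact ⟨by omega, hlab⟩

end Passes

/-! ### Transitive partitions of two nested cliques -/

section Cochain

variable {V : Type*}

/-- A transitive partition with respect to a relation `R` on the vertices. For the relation
`G.edist u v ≤ 2` this is a `d₂`-transitive partition of `G`. -/
def IsTransitiveFor (R : V → V → Prop) {k : ℕ} (P : Fin k → Set V) : Prop :=
  IsVertexPartition P ∧ ∀ i j, i < j → ∀ b ∈ P j, ∃ a ∈ P i, R a b

/-- The relation `R` consists of two cliques `X` and `Y` with nested neighbourhoods between them,
and of isolated vertices. -/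
structure IsCochain (R : V → V → Prop) (X Y : Finset V) : Prop where
  symm : ∀ u v, R u v → R v u
  disj : Disjoint X Y
  cliqueX : ∀ x ∈ X, ∀ x' ∈ X, R x x'
  cliqueY : ∀ y ∈ Y, ∀ y' ∈ Y, R y y'
  chainX : ∀ x ∈ X, ∀ x' ∈ X, (∀ y ∈ Y, R x y → R x' y) ∨ ∀ y ∈ Y, R x' y → R x y
  chainY : ∀ y ∈ Y, ∀ y' ∈ Y, (∀ x ∈ X, R y x → R y' x) ∨ ∀ x ∈ X, R y' x → R y x
  isolated : ∀ u, u ∉ X → u ∉ Y → ∀ v, R u v → u = v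

variable {R : V → V → Prop} {X Y : Finset V}

theorem IsCochain.swap (h : IsCochain R X Y) : IsCochain R Y X :=
  ⟨h.symm, h.disj.symm, h.cliqueY, h.cliqueX, h.chainY, h.chainX,
    fun u hY hX => h.isolated u hX hY⟩

/-- Among nested neighbourhoods there is a largest one. -/
theorem exists_forall_imp_of_chain {S : Finset V} (hS : S.Nonempty) {T : Finset V}
    (hchain : ∀ x ∈ S, ∀ x' ∈ S, (∀ y ∈ T, R x y → R x' y) ∨ ∀ y ∈ T, R x' y → R x y) :
    ∃ x ∈ S, ∀ a ∈ S, ∀ y ∈ T, R a y → R x y := by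
  classical
  obtain ⟨x, hx, hmax⟩ := S.exists_max_image (fun x => (T.filter (R x)).card) hS
  refine ⟨x, hx, fun a ha => ?_⟩
  rcases hchain a ha x hx with h | h
  · exact h
  · intro y hy hay
    have hsub : T.filter (R x) ⊆ T.filter (R a) := fun y hy => by
      rw [Finset.mem_filter] at hy ⊢
      exact ⟨hy.1, h y hy.1 hy.2⟩
    have := Finset.eq_of_subset_of_card_le hsub (hmax a ha)
    have hy' : y ∈ T.filter (R a) := Finset.mem_filter.2 ⟨hy, hay⟩
    rw [← this] at hy'
    exact (Finset.mem_filter.1 hy').2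

theorem IsVertexPartition.card_le_of_forall_exists_mem {k : ℕ} {P : Fin k → Set V}
    (hP : IsVertexPartition P) {I : Finset (Fin k)} {S : Finset V}
    (h : ∀ i ∈ I, ∃ v ∈ P i, v ∈ S) : I.card ≤ S.card := by
  rcases I.eq_empty_or_nonempty with rfl | ⟨i, hi⟩
  · simp
  have : Nonempty V := ⟨(h i hi).choose⟩
  choose! f hf hS using h
  refine Finset.card_le_card_of_injOn f hS fun i hi j hj hij => ?_
  by_contra hne
  exact Set.disjoint_left.1 (hP.2.1 i j hne) (hf i hi) (hij ▸ hf j hj)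

/-- From every part that misses `Y`, take a vertex of `X` with the largest neighbourhood, and
similarly from every part that misses `X`. These vertices form a clique: of two such parts, the
earlier one dominates the later one. -/
theorem IsCochain.exists_biclique (h : IsCochain R X Y) {k : ℕ} {P : Fin k → Set V}
    (hP : IsTransitiveFor R P) (hne : ∀ i, ∃ v ∈ P i, v ∈ X ∨ v ∈ Y) :
    ∃ A ⊆ X, ∃ B ⊆ Y, k ≤ A.card + Y.card ∧ k ≤ B.card + X.card ∧
      ∀ a ∈ A, ∀ b ∈ B, R a b := by
  classical
  obtain rfl | hk := Nat.eq_zero_or_pos k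
  · exact ⟨∅, by simp, ∅, by simp, by simp, by simp, by simp⟩
  have : Nonempty V := ⟨(hne ⟨0, hk⟩).choose⟩
  -- one half of the construction, used for `(X, Y)` and for `(Y, X)`
  have half : ∀ X Y : Finset V, IsCochain R X Y → (∀ i, ∃ v ∈ P i, v ∈ X ∨ v ∈ Y) →
      ∃ A ⊆ X, k ≤ A.card + Y.card ∧ ∀ a ∈ A, ∃ i, a ∈ P i ∧ (∀ v ∈ P i, v ∉ Y) ∧
        ∀ v ∈ P i, v ∈ X → ∀ y ∈ Y, R v y → R a y := by
    intro X Y h hne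
    have hx : ∀ i, (∀ v ∈ P i, v ∉ Y) →
        ∃ x ∈ X, x ∈ P i ∧ ∀ v ∈ P i, v ∈ X → ∀ y ∈ Y, R v y → R x y := by
      intro i hi
      obtain ⟨v, hv, hvXY⟩ := hne i
      have hvX := hvXY.resolve_right (hi v hv)
      obtain ⟨x, hx, hmax⟩ := exists_forall_imp_of_chain (R := R) (T := Y)
        (S := X.filter (· ∈ P i)) ⟨v, Finset.mem_filter.2 ⟨hvX, hv⟩⟩ fun x hx x' hx' =>
          h.chainX x (Finset.mem_filter.1 hx).1 x' (Finset.mem_filter.1 hx').1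
      rw [Finset.mem_filter] at hx
      exact ⟨x, hx.1, hx.2, fun v hv hvX => hmax v (Finset.mem_filter.2 ⟨hvX, hv⟩)⟩
    choose! f hfX hfP hfmax using hx
    set I := Finset.univ.filter fun i => ∀ v ∈ P i, v ∉ Y
    refine ⟨I.image f, ?_, ?_, ?_⟩
    · intro a ha
      obtain ⟨i, hi, rfl⟩ := Finset.mem_image.1 ha
      exact hfX i (Finset.mem_filter.1 hi).2
    · rw [Finset.card_image_of_injOn]
      · have h1 := hP.1.card_le_of_forall_exists_mem (I := Iᶜ) (S := Y) fun i hi => by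
          simpa [I] using hi
        rw [Finset.card_compl, Fintype.card_fin] at h1
        omega
      · intro i hi j hj hij
        by_contra hne
        refine Set.disjoint_left.1 (hP.1.2.1 i j hne) (hfP i (Finset.mem_filter.1 hi).2) ?_
        rw [hij]
        exact hfP j (Finset.mem_filter.1 hj).2
    · intro a ha
      obtain ⟨i, hi, rfl⟩ := Finset.mem_image.1 ha
      have hi := (Finset.mem_filter.1 hi).2
      exact ⟨i, hfP i hi, hi, hfmax i hi⟩
  obtain ⟨A, hAX, hA, hA'⟩ := half X Y h hne
  obtain ⟨B, hBY, hB, hB'⟩ := half Y X h.swap fun i =>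
    (hne i).imp fun v hv => ⟨hv.1, hv.2.symm⟩
  refine ⟨A, hAX, B, hBY, hA, hB, fun a ha b hb => ?_⟩
  obtain ⟨i, hai, hi, hia⟩ := hA' a ha
  obtain ⟨j, hbj, hj, hjb⟩ := hB' b hb
  have hbY := hBY hb
  have haX := hAX ha
  rcases lt_trichotomy i j with hij | rfl | hij
  · obtain ⟨v, hv, hvb⟩ := hP.2 i j hij b hbj
    by_cases hvX : v ∈ X
    · exact hia v hv hvX b hbY hvb
    · exact absurd (h.isolated v hvX (hi v hv) b hvb ▸ hbY) (hi v hv)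
  · exact absurd haX (hj a hai)
  · obtain ⟨v, hv, hva⟩ := hP.2 j i hij a hai
    by_cases hvY : v ∈ Y
    · exact h.symm _ _ (hjb v hv hvY a haX hva)
    · exact absurd (h.isolated v (hj v hv) hvY a hva ▸ haX) (hj v hv)

/-- Isolated vertices can only lie in the first part. -/
theorem IsCochain.exists_mem_of_two_le (h : IsCochain R X Y) {k : ℕ} {P : Fin k → Set V}
    (hP : IsTransitiveFor R P) (hk : 2 ≤ k) (i : Fin k) : ∃ v ∈ P i, v ∈ X ∨ v ∈ Y := by
  by_contra! hi
  have hiso : ∀ v ∈ P i, ∀ w, (R v w ∨ R w v) → v = w := fun v hv w hvw =>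
    h.isolated v (hi v hv).1 (hi v hv).2 w (hvw.elim id (h.symm _ _))
  rcases Nat.eq_zero_or_pos (i : ℕ) with h0 | h0
  · obtain ⟨b, hb⟩ := hP.1.1 ⟨1, hk⟩
    have hlt : i < ⟨1, hk⟩ := by rw [Fin.lt_def]; simp [h0]
    obtain ⟨a, ha, hab⟩ := hP.2 _ _ hlt b hb
    obtain rfl := hiso a ha b (Or.inl hab)
    exact Set.disjoint_left.1 (hP.1.2.1 _ _ hlt.ne) ha hb
  · obtain ⟨b, hb⟩ := hP.1.1 i
    have hlt : (⟨0, by omega⟩ : Fin k) < i := by rw [Fin.lt_def]; exact h0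
    obtain ⟨a, ha, hab⟩ := hP.2 _ _ hlt b hb
    obtain rfl := hiso b hb a (Or.inr hab)
    exact Set.disjoint_left.1 (hP.1.2.1 _ _ hlt.ne) ha hb

end Cochain

section Label

variable {n : ℕ}

theorem card_filter_range_eq (p : ℕ → Prop) [DecidablePred p] :
    ((Finset.range n).filter p).card = (Finset.univ.filter fun v : Fin n => p v).card := by
  rw [← Finset.card_map Fin.valEmbedding]
  congr 1
  ext w
  simp only [Finset.mem_filter, Finset.mem_range, Finset.mem_map, Finset.mem_univ, true_and]
  exact ⟨fun h => ⟨⟨w, h.1⟩, h.2, rfl⟩, by rintro ⟨v, hv, rfl⟩; exact ⟨v.2, hv⟩⟩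

/-- The vertices of one mark are numbered without gaps. -/
theorem exists_card_filter_range_eq (f : ℕ → ℕ) (x : ℕ) {r : ℕ}
    (hr : r < ((Finset.range n).filter fun w => f w = x).card) :
    ∃ v < n, f v = x ∧ ((Finset.range v).filter fun w => f w = x).card = r := by
  induction n with
  | zero => simp at hr
  | succ n ih =>
    by_cases h : r < ((Finset.range n).filter fun w => f w = x).card
    · obtain ⟨v, hv, h⟩ := ih h
      exact ⟨v, by omega, h⟩
    · rw [card_filter_range_succ] at hr
      split_ifs at hr with hx
      · exact ⟨n, by omega, hx, by omega⟩
      · omega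

theorem card_filter_range_lt (f : ℕ → ℕ) {v : ℕ} (hv : v < n) :
    ((Finset.range v).filter fun w => f w = f v).card <
      ((Finset.range n).filter fun w => f w = f v).card := by
  have h := card_filter_range_succ v fun w => f w = f v
  rw [if_pos rfl] at h
  have : ((Finset.range (v + 1)).filter fun w => f w = f v).card ≤
      ((Finset.range n).filter fun w => f w = f v).card :=
    Finset.card_le_card (Finset.filter_subset_filter _ (Finset.range_mono hv))
  omega

variable {R : Fin n → Fin n → Prop} {X Y A B : Finset (Fin n)}

/-- A clique `A ∪ B` yields a transitive partition: the vertices of the clique form singletons,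
and the rest of `X` and the rest of `Y`, if of the same size `c`, are matched to form pairs, each
of which dominates everything; these come first. Isolated vertices are added to the first part. -/
theorem IsCochain.isTransitiveFor_label (h : IsCochain R X Y) (hA : A ⊆ X) (hB : B ⊆ Y)
    (hAB : ∀ a ∈ A, ∀ b ∈ B, R a b) {c k : ℕ} (hcX : X.card = A.card + c)
    (hcY : Y.card = B.card + c) (hk : k = c + (A.card + B.card)) (hpos : 0 < k) {f : ℕ → ℕ}
    (hf : ∀ v : Fin n, f v =
      if v ∈ A ∨ v ∈ B then 2 else if v ∈ X then 0 else if v ∈ Y then 1 else 3)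
    {lab : Fin n → ℕ} (hlab : ∀ v : Fin n, lab v = label f c v) :
    IsTransitiveFor R fun i : Fin k => {v | lab v = i} := by
  have hXY : ∀ v ∈ X, v ∉ Y := fun v hv => Finset.disjoint_left.1 h.disj hv
  have e0 : ∀ v : Fin n, f v = 0 ↔ v ∈ X \ A := fun v => by
    have := hXY v; have := @hA v; have := @hB v
    rw [hf]; grind
  have e1 : ∀ v : Fin n, f v = 1 ↔ v ∈ Y \ B := fun v => by
    have := hXY v; have := @hA v; have := @hB v
    rw [hf]; grind
  have e2 : ∀ v : Fin n, f v = 2 ↔ v ∈ A ∪ B := fun v => by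
    rw [hf]; split_ifs <;> simp_all
  have c0 : ((Finset.range n).filter fun w => f w = 0).card = c := by
    rw [card_filter_range_eq]
    simp only [e0, Finset.filter_univ_mem, Finset.card_sdiff_of_subset hA]
    omega
  have c1 : ((Finset.range n).filter fun w => f w = 1).card = c := by
    rw [card_filter_range_eq]
    simp only [e1, Finset.filter_univ_mem, Finset.card_sdiff_of_subset hB]
    omega
  have c2 : ((Finset.range n).filter fun w => f w = 2).card = A.card + B.card := by
    rw [card_filter_range_eq]
    simp only [e2, Finset.filter_univ_mem]
    exact Finset.card_union_of_disjoint (Finset.disjoint_of_subset_left hA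
      (Finset.disjoint_of_subset_right hB h.disj))
  have low0 : ∀ i < c, ∃ x ∈ X, lab x = i := fun i hi => by
    obtain ⟨v, hv, hfv, hr⟩ := exists_card_filter_range_eq f 0 (hi.trans_eq c0.symm)
    exact ⟨⟨v, hv⟩, (Finset.mem_sdiff.1 ((e0 ⟨v, hv⟩).1 hfv)).1, by simp [hlab, label, hfv, hr]⟩
  have low1 : ∀ i < c, ∃ y ∈ Y, lab y = i := fun i hi => by
    obtain ⟨v, hv, hfv, hr⟩ := exists_card_filter_range_eq f 1 (hi.trans_eq c1.symm)
    exact ⟨⟨v, hv⟩, (Finset.mem_sdiff.1 ((e1 ⟨v, hv⟩).1 hfv)).1, by simp [hlab, label, hfv, hr]⟩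
  have high : ∀ i, c ≤ i → i < k → ∃ z ∈ A ∪ B, lab z = i := fun i hi hik => by
    obtain ⟨v, hv, hfv, hr⟩ := exists_card_filter_range_eq (n := n) f 2 (r := i - c) (by omega)
    exact ⟨⟨v, hv⟩, (e2 ⟨v, hv⟩).1 hfv, by simp [hlab, label, hfv, hr]; omega⟩
  have bound : ∀ v, lab v < k ∧ (0 < lab v → v ∈ X ∨ v ∈ Y) ∧
      (c ≤ lab v → v ∈ A ∪ B ∨ lab v = 0) := fun v => by
    have hr := card_filter_range_lt f v.2
    have h0 := e0 v
    have h1 := e1 v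
    have h2 := e2 v
    simp only [Finset.mem_sdiff, Finset.mem_union] at h0 h1 h2 ⊢
    have := @hA v
    have := @hB v
    rw [hlab, label]
    by_cases h01 : f v ≤ 1
    · rw [if_pos h01]
      rcases Nat.le_one_iff_eq_zero_or_eq_one.1 h01 with h | h <;> rw [h] at hr ⊢
      · exact ⟨by omega, fun _ => Or.inl (h0.1 h).1, by omega⟩
      · exact ⟨by omega, fun _ => Or.inr (h1.1 h).1, by omega⟩
    · rw [if_neg h01]
      by_cases h : f v = 2
      · rw [if_pos h]
        rw [h] at hr ⊢
        exact ⟨by omega, fun _ => by tauto, fun _ => Or.inl (h2.1 h)⟩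
      · rw [if_neg h]
        exact ⟨hpos, by omega, by omega⟩
  refine ⟨⟨fun i => ?_, fun i j hij => ?_, ?_⟩, fun i j hij b hb => ?_⟩
  · rcases lt_or_ge (i : ℕ) c with hi | hi
    · obtain ⟨x, -, hx⟩ := low0 i hi
      exact ⟨x, hx⟩
    · obtain ⟨z, -, hz⟩ := high i hi i.2
      exact ⟨z, hz⟩
  · rw [Set.disjoint_left]
    intro v hi hj
    exact hij (Fin.ext (hi.symm.trans hj))
  · exact Set.eq_univ_of_forall fun v => Set.mem_iUnion.2 ⟨⟨lab v, (bound v).1⟩, rfl⟩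
  · change lab b = j at hb
    rw [Fin.lt_def] at hij
    obtain ⟨-, hb1, hb2⟩ := bound b
    rcases lt_or_ge (i : ℕ) c with hi | hi
    · rcases hb1 (by omega) with hbX | hbY
      · obtain ⟨x, hx, hxi⟩ := low0 i hi
        exact ⟨x, hxi, h.cliqueX x hx b hbX⟩
      · obtain ⟨y, hy, hyi⟩ := low1 i hi
        exact ⟨y, hyi, h.cliqueY y hy b hbY⟩
    · obtain ⟨z, hz, hzi⟩ := high i hi i.2
      have hbAB : b ∈ A ∪ B := (hb2 (by omega)).resolve_right (by omega)
      refine ⟨z, hzi, ?_⟩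
      rcases Finset.mem_union.1 hz with hz | hz <;> rcases Finset.mem_union.1 hbAB with hb | hb
      · exact h.cliqueX z (hA hz) b (hA hb)
      · exact hAB z hz b hb
      · exact h.symm _ _ (hAB b hb z hz)
      · exact h.cliqueY z (hB hz) b (hB hb)

end Label

/-! ### Existence of transitive partitions -/

section Existence

open scoped Classical in
/-- The number of neighbours of `x` in `Y`. -/
noncomputable def crossDegree {V : Type*} (R : V → V → Prop) (Y : Finset V) (x : V) : ℕ :=
  (Y.filter (R x)).card

variable {V : Type*} {R : V → V → Prop} {X Y : Finset V}

theorem card_le_crossDegree {B : Finset V} (hB : B ⊆ Y) {x : V} (hx : ∀ b ∈ B, R x b) :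
    B.card ≤ crossDegree R Y x := by
  classical
  exact Finset.card_le_card fun b hb => Finset.mem_filter.2 ⟨hB hb, hx b hb⟩

/-- For vertices with nested neighbourhoods, inclusion is decided by the degrees. -/
theorem IsCochain.imp_of_crossDegree_le (h : IsCochain R X Y) {x a : V} (hx : x ∈ X) (ha : a ∈ X)
    (hxa : crossDegree R Y x ≤ crossDegree R Y a) {y : V} (hy : y ∈ Y) (hxy : R x y) : R a y := by
  classical
  rcases h.chainX x hx a ha with h' | h'
  · exact h' y hy hxy
  · have hsub : Y.filter (R a) ⊆ Y.filter (R x) := fun y hy => by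
      rw [Finset.mem_filter] at hy ⊢
      exact ⟨hy.1, h' y hy.1 hy.2⟩
    have := Finset.eq_of_subset_of_card_le hsub (by simpa [crossDegree] using hxa)
    have hy' : y ∈ Y.filter (R x) := Finset.mem_filter.2 ⟨hy, hxy⟩
    rw [← this] at hy'
    exact (Finset.mem_filter.1 hy').2

/-- If `k - |Y|` vertices of `X` have at least `k - |X|` neighbours in `Y`, then the neighbours of one
of them of smallest degree complete them to a clique. -/
theorem IsCochain.exists_isTransitiveFor {n : ℕ} {R : Fin n → Fin n → Prop}
    {X Y A : Finset (Fin n)} (h : IsCochain R X Y) {k : ℕ} (hpos : 0 < k) (hXk : X.card ≤ k)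
    (hYk : Y.card ≤ k) (hA : A ⊆ X) (hAk : k ≤ Y.card + A.card)
    (hAd : ∀ a ∈ A, k ≤ X.card + crossDegree R Y a) :
    ∃ P : Fin k → Set (Fin n), IsTransitiveFor R P := by
  classical
  obtain ⟨A', hA'A, hA'⟩ := Finset.exists_subset_card_eq (show k - Y.card ≤ A.card by omega)
  have hAX := Finset.card_le_card hA
  obtain ⟨B, hBY, hBk, hAB⟩ : ∃ B ⊆ Y, B.card = k - X.card ∧ ∀ a ∈ A', ∀ b ∈ B, R a b := by
    rcases A'.eq_empty_or_nonempty with rfl | hne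
    · obtain ⟨B, hB, hB'⟩ := Finset.exists_subset_card_eq (show k - X.card ≤ Y.card by omega)
      exact ⟨B, hB, hB', by simp⟩
    · obtain ⟨x, hx, hmin⟩ := A'.exists_min_image (crossDegree R Y) hne
      obtain ⟨B, hB, hB'⟩ := Finset.exists_subset_card_eq
        (show k - X.card ≤ (Y.filter (R x)).card by
          have := hAd x (hA'A hx)
          unfold crossDegree at this
          omega)
      refine ⟨B, fun b hb => (Finset.mem_filter.1 (hB hb)).1, hB', fun a ha b hb => ?_⟩
      obtain ⟨hbY, hxb⟩ := Finset.mem_filter.1 (hB hb)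
      exact h.imp_of_crossDegree_le (hA (hA'A hx)) (hA (hA'A ha)) (hmin a ha) hbY hxb
  let f : ℕ → ℕ := fun i => if hi : i < n then
    if ⟨i, hi⟩ ∈ A' ∨ ⟨i, hi⟩ ∈ B then 2 else if (⟨i, hi⟩ : Fin n) ∈ X then 0
    else if (⟨i, hi⟩ : Fin n) ∈ Y then 1 else 3 else 3
  exact ⟨_, h.isTransitiveFor_label (hA'A.trans hA) hBY hAB (c := X.card + Y.card - k)
    (by omega) (by omega) (by omega) hpos (f := f) (fun v => by simp [f]) fun v => rfl⟩

end Existence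

/-! ### Complements of bipartite chain graphs -/

section Complement

universe u

variable {V : Type u} {G : SimpleGraph V}

theorem neighborSet_subset_or_of_antitone {X : Set V} {p : ℕ} (σ : Fin p ≃ X)
    (hσ : Antitone fun i => G.neighborSet (σ i : V)) {x x' : V} (hx : x ∈ X) (hx' : x' ∈ X) :
    G.neighborSet x ⊆ G.neighborSet x' ∨ G.neighborSet x' ⊆ G.neighborSet x := by
  rcases le_total (σ.symm ⟨x, hx⟩) (σ.symm ⟨x', hx'⟩) with h | h
  · right; simpa using hσ h
  · left; simpa using hσ h

/-- The two sides of a bipartite chain graph; the neighbourhoods of any two vertices of the same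
side are comparable. -/
theorem IsBipartiteChain.exists_sides (h : IsBipartiteChain G) :
    ∃ X Y : Set V, G.IsBipartiteWith X Y ∧ X ∪ Y = Set.univ ∧
      (∀ x ∈ X, ∀ x' ∈ X, G.neighborSet x ⊆ G.neighborSet x' ∨
        G.neighborSet x' ⊆ G.neighborSet x) ∧
      ∀ y ∈ Y, ∀ y' ∈ Y, G.neighborSet y ⊆ G.neighborSet y' ∨
        G.neighborSet y' ⊆ G.neighborSet y := by
  obtain ⟨X, Y, hXY, hcov, p, q, σ, τ, hσ, hτ⟩ := h
  exact ⟨X, Y, hXY, hcov, fun x hx x' hx' => neighborSet_subset_or_of_antitone σ hσ hx hx',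
    fun y hy y' hy' => neighborSet_subset_or_of_antitone τ hτ hy hy'⟩

theorem isTransitivePartition_iff {k : ℕ} {P : Fin k → Set V} :
    IsTransitivePartition G P ↔ IsTransitiveFor (fun u v => u = v ∨ G.Adj u v) P := by
  refine and_congr_right fun hP => ⟨fun h i j hij b hb => ?_, fun h i j hij b hb => ?_⟩
  · obtain ⟨a, ha, hab⟩ := h i j hij b hb
    exact ⟨a, ha, Or.inr hab⟩
  · obtain ⟨a, ha, rfl | hab⟩ := h i j hij b hb
    · exact absurd hb (Set.disjoint_left.1 (hP.2.1 i j hij.ne) ha)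
    · exact ⟨a, ha, hab⟩

/-- The complement of a bipartite chain graph consists of two nested cliques. -/
theorem exists_isCochain_of_compl [Fintype V] (h : IsBipartiteChain Gᶜ) :
    ∃ X Y : Finset V, IsCochain (fun u v => u = v ∨ G.Adj u v) X Y ∧ ∀ v, v ∈ X ∨ v ∈ Y := by
  classical
  obtain ⟨X, Y, hXY, hcov, hX, hY⟩ := h.exists_sides
  have hdisj := Set.disjoint_left.1 hXY.disjoint
  have hcl : ∀ u v, ¬ Gᶜ.Adj u v → u = v ∨ G.Adj u v := fun u v huv => by
    rw [SimpleGraph.compl_adj] at huv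
    tauto
  have hclX : ∀ x ∈ X, ∀ x' ∈ X, x = x' ∨ G.Adj x x' := fun x hx x' hx' =>
    hcl _ _ fun hadj => (hXY.mem_of_adj hadj).elim (fun h => hdisj hx' h.2) fun h => hdisj hx h.1
  have hclY : ∀ y ∈ Y, ∀ y' ∈ Y, y = y' ∨ G.Adj y y' := fun y hy y' hy' =>
    hcl _ _ fun hadj => (hXY.mem_of_adj hadj).elim (fun h => hdisj h.1 hy) fun h => hdisj h.2 hy'
  have hchain : ∀ u u' : V, ∀ T : Finset V, (∀ y ∈ T, u ≠ y) → (∀ y ∈ T, u' ≠ y) →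
      Gᶜ.neighborSet u ⊆ Gᶜ.neighborSet u' → ∀ y ∈ T, (u' = y ∨ G.Adj u' y) →
        (u = y ∨ G.Adj u y) := fun u u' T hu hu' hsub y hy huy => by
    have := @hsub y
    simp only [SimpleGraph.mem_neighborSet, SimpleGraph.compl_adj] at this
    have := hu y hy
    have := hu' y hy
    tauto
  have hneX : ∀ x ∈ X, ∀ y ∈ Y.toFinset, x ≠ y := by
    rintro x hx y hy rfl
    exact hdisj hx (Set.mem_toFinset.1 hy)
  have hneY : ∀ y ∈ Y, ∀ x ∈ X.toFinset, y ≠ x := by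
    rintro y hy x hx rfl
    exact hdisj (Set.mem_toFinset.1 hx) hy
  refine ⟨X.toFinset, Y.toFinset, ⟨?_, ?_, ?_, ?_, ?_, ?_, ?_⟩, ?_⟩
  · rintro u v (rfl | h)
    · exact Or.inl rfl
    · exact Or.inr h.symm
  · simpa using hXY.disjoint
  · simpa using hclX
  · simpa using hclY
  · simp only [Set.mem_toFinset]
    intro x hx x' hx'
    rcases hX x hx x' hx' with h | h
    · right
      simpa using hchain x x' _ (hneX x hx) (hneX x' hx') h
    · left
      simpa using hchain x' x _ (hneX x' hx') (hneX x hx) h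
  · simp only [Set.mem_toFinset]
    intro y hy y' hy'
    rcases hY y hy y' hy' with h | h
    · right
      simpa using hchain y y' _ (hneY y hy) (hneY y' hy') h
    · left
      simpa using hchain y' y _ (hneY y' hy') (hneY y hy) h
  · intro u hu hu'
    rcases hcov.ge (Set.mem_univ u) with h | h
    · exact absurd (Set.mem_toFinset.2 h) hu
    · exact absurd (Set.mem_toFinset.2 h) hu'
  · intro v
    simpa using hcov.ge (Set.mem_univ v)

open scoped Classical in
/-- The transitivity of the complement of a bipartite chain graph, in terms of the degrees: a
vertex of the clique `X` with `d` neighbours in the clique `Y` has degree `|X| - 1 + d`. -/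
theorem isGreatest_transitivity_of_compl {n : ℕ} {G : SimpleGraph (Fin n)}
    (h : IsBipartiteChain Gᶜ) :
    IsGreatest {k | 2 * k ≤ n + (Finset.univ.filter fun v => k ≤ G.degree v + 1).card}
      (transitivity G) := by
  obtain ⟨X, Y, hR, hcov⟩ := exists_isCochain_of_compl h
  have hiff : ∀ (k : ℕ) (P : Fin k → Set (Fin n)), IsTransitivePartition G P ↔ _ :=
    fun k P => isTransitivePartition_iff
  generalize hRdef : (fun u v => u = v ∨ G.Adj u v) = R at hR hiff
  have hRiff : ∀ u v, R u v ↔ u = v ∨ G.Adj u v := fun u v => by rw [← hRdef]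
  have hn : X.card + Y.card = n := by
    rw [← Finset.card_union_of_disjoint hR.disj]
    have : X ∪ Y = Finset.univ := Finset.eq_univ_of_forall fun v => by simpa using hcov v
    simp [this]
  have hdeg : ∀ X Y : Finset (Fin n), IsCochain R X Y → (∀ v, v ∈ X ∨ v ∈ Y) →
      ∀ x ∈ X, G.degree x + 1 = X.card + crossDegree R Y x := by
    intro X Y hR hcov x hx
    have hdis : Disjoint X (Y.filter (R x)) :=
      Finset.disjoint_of_subset_right (Finset.filter_subset _ _) hR.disj
    rw [crossDegree, ← Finset.card_union_of_disjoint hdis, ← G.card_neighborFinset_eq_degree,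
      ← Finset.card_insert_of_notMem (G.notMem_neighborFinset_self x)]
    congr 1
    ext v
    have := hR.cliqueX x hx v
    have := hcov v
    have := Finset.disjoint_left.1 hR.disj hx
    simp only [hRiff, Finset.mem_insert, SimpleGraph.mem_neighborFinset, Finset.mem_union,
      Finset.mem_filter] at *
    grind
  obtain ⟨⟨P, hP⟩, hmax⟩ := isGreatest_transitivity G
  constructor
  · obtain ⟨A, hA, B, hB, hkA, hkB, hAB⟩ := hR.exists_biclique ((hiff _ P).1 hP)
      fun i => (hP.1.1 i).imp fun v hv => ⟨hv, hcov v⟩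
    have hsub : A ∪ B ⊆ Finset.univ.filter fun v => transitivity G ≤ G.degree v + 1 := by
      intro v hv
      rw [Finset.mem_filter]
      refine ⟨Finset.mem_univ v, ?_⟩
      rcases Finset.mem_union.1 hv with hv | hv
      · have : B.card ≤ crossDegree R Y v := card_le_crossDegree hB (hAB v hv)
        rw [hdeg X Y hR hcov v (hA hv)]
        omega
      · have : A.card ≤ crossDegree R X v :=
          card_le_crossDegree hA fun a ha => hR.symm _ _ (hAB a ha v hv)
        rw [hdeg Y X hR.swap (fun v => (hcov v).symm) v (hB hv)]
        omega
    have := Finset.card_le_card hsub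
    rw [Finset.card_union_of_disjoint (Finset.disjoint_of_subset_left hA
      (Finset.disjoint_of_subset_right hB hR.disj))] at this
    rw [Set.mem_ofPred_eq]
    omega
  · intro k hk
    rw [Set.mem_ofPred_eq] at hk
    -- the bound as a sum over the two sides
    have hsplit : (Finset.univ.filter fun v => k ≤ G.degree v + 1).card =
        (X.filter fun v => k ≤ G.degree v + 1).card +
          (Y.filter fun v => k ≤ G.degree v + 1).card := by
      rw [← Finset.card_union_of_disjoint (Finset.disjoint_filter_filter hR.disj),
        ← Finset.filter_union]
      congr 2
      exact (Finset.eq_univ_of_forall fun v => by simpa using hcov v).symm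
    have key : ∀ X Y : Finset (Fin n), IsCochain R X Y → (∀ v, v ∈ X ∨ v ∈ Y) →
        X.card + Y.card = n → Y.card ≤ X.card →
        2 * k ≤ n + ((X.filter fun v => k ≤ G.degree v + 1).card +
          (Y.filter fun v => k ≤ G.degree v + 1).card) → k ≤ transitivity G := by
      clear hsplit hn hcov hR X Y
      intro X Y hR hcov hn hYX hk
      rcases Nat.eq_zero_or_pos k with rfl | hpos
      · exact Nat.zero_le _
      have fin : ∀ m (P : Fin m → Set (Fin n)), IsTransitiveFor R P → m ≤ transitivity G :=
        fun m P hP => hmax ⟨P, (hiff _ P).2 hP⟩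
      have hcX := Finset.card_filter_le X fun v => k ≤ G.degree v + 1
      have hcY := Finset.card_filter_le Y fun v => k ≤ G.degree v + 1
      -- the order `|X|` is always attained; beyond it, the bound gives enough vertices in `X`
      -- or in `Y`
      rcases le_or_gt k X.card with hkX | hkX
      · obtain ⟨P, hP⟩ := hR.exists_isTransitiveFor (k := X.card) (A := X) (by omega) le_rfl hYX
          (Finset.Subset.refl X) (by omega) fun a _ => by omega
        exact hkX.trans (fin _ P hP)
      · have hX' : ∀ a ∈ X.filter fun v => k ≤ G.degree v + 1, k ≤ X.card + crossDegree R Y a :=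
          fun a ha => by
            rw [Finset.mem_filter] at ha
            rw [← hdeg X Y hR hcov a ha.1]
            exact ha.2
        have hY' : ∀ a ∈ Y.filter fun v => k ≤ G.degree v + 1, k ≤ Y.card + crossDegree R X a :=
          fun a ha => by
            rw [Finset.mem_filter] at ha
            rw [← hdeg Y X hR.swap (fun v => (hcov v).symm) a ha.1]
            exact ha.2
        rcases le_or_gt k (Y.card + (X.filter fun v => k ≤ G.degree v + 1).card) with h1 | h1
        · obtain ⟨P, hP⟩ := hR.exists_isTransitiveFor hpos hkX.le (by omega)
            (Finset.filter_subset _ _) h1 hX'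
          exact fin _ P hP
        · obtain ⟨P, hP⟩ := hR.swap.exists_isTransitiveFor hpos (by omega) hkX.le
            (Finset.filter_subset _ _) (by omega) hY'
          exact fin _ P hP
    rw [hsplit] at hk
    rcases le_total Y.card X.card with hle | hle
    · exact key X Y hR hcov hn hle hk
    · exact key Y X hR.swap (fun v => (hcov v).symm) (by omega) hle (by omega)

end Complement

/-! ### The square of a bipartite chain graph -/

section Square

universe u

variable {V : Type u} {G : SimpleGraph V}

theorem edist_le_two_iff {u v : V} :
    G.edist u v ≤ 2 ↔ u = v ∨ G.Adj u v ∨ ∃ w, G.Adj u w ∧ G.Adj w v := by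
  constructor
  · intro h
    have hne : G.edist u v ≠ ⊤ := fun h' => by rw [h'] at h; exact absurd h (by decide)
    obtain ⟨p, hp⟩ := SimpleGraph.exists_walk_of_edist_ne_top hne
    rw [← hp] at h
    have h : p.length ≤ 2 := by exact_mod_cast h
    match p, h with
    | .nil, _ => exact Or.inl rfl
    | .cons h₁ .nil, _ => exact Or.inr (Or.inl h₁)
    | .cons h₁ (.cons h₂ .nil), _ => exact Or.inr (Or.inr ⟨_, h₁, h₂⟩)
    | .cons h₁ (.cons h₂ (.cons h₃ p)), h => simp at h
  · rintro (rfl | h | ⟨w, h₁, h₂⟩)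
    · simp
    · exact (SimpleGraph.edist_le h.toWalk).trans (by simp)
    · exact (SimpleGraph.edist_le (.cons h₁ (.cons h₂ .nil))).trans (by simp)

/-- Vertices of the same side, not isolated, have a common neighbour. -/
theorem edist_le_two_of_subset {u v w : V}
    (h : G.neighborSet u ⊆ G.neighborSet v ∨ G.neighborSet v ⊆ G.neighborSet u)
    (hu : G.Adj u w) {w' : V} (hv : G.Adj v w') : G.edist u v ≤ 2 := by
  rw [edist_le_two_iff]
  right; right
  rcases h with h | h
  · exact ⟨w, hu, (h hu : G.Adj v w).symm⟩
  · exact ⟨w', h hv, hv.symm⟩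

/-- Vertices of different sides are at odd distance. -/
theorem edist_le_two_iff_adj {X Y : Set V} (hXY : G.IsBipartiteWith X Y) {x y : V} (hx : x ∈ X)
    (hy : y ∈ Y) : G.edist x y ≤ 2 ↔ G.Adj x y := by
  have hdisj := Set.disjoint_left.1 hXY.disjoint
  rw [edist_le_two_iff]
  refine ⟨?_, fun h => Or.inr (Or.inl h)⟩
  rintro (rfl | h | ⟨w, h₁, h₂⟩)
  · exact absurd hy (hdisj hx)
  · exact h
  · have hwY : w ∈ Y := (hXY.mem_of_adj h₁).elim (fun h => h.2) fun h => absurd h.1 (hdisj hx)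
    exact ((hXY.mem_of_adj h₂).elim (fun h => absurd hwY (hdisj h.1))
      fun h => absurd hy (hdisj h.2))

/-- The graph `H` joins the vertices of different sides that are not adjacent in `G`. -/
theorem exists_square_eq_compl (hG : G.Connected) (h : IsBipartiteChain G) :
    ∃ H : SimpleGraph V, IsBipartiteChain H ∧ square G = Hᶜ := by
  obtain ⟨X, Y, hXY, hcov, p, q, σ, τ, hσ, hτ⟩ := h
  have hdisj := Set.disjoint_left.1 hXY.disjoint
  let H : SimpleGraph V :=
    { Adj := fun u v => ((u ∈ X ∧ v ∈ Y) ∨ (u ∈ Y ∧ v ∈ X)) ∧ ¬ G.Adj u v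
      symm := ⟨fun u v h => ⟨by tauto, fun h' => h.2 h'.symm⟩⟩
      loopless := ⟨fun u h => h.1.elim (fun h => hdisj h.1 h.2) fun h => hdisj h.2 h.1⟩ }
  have hHX : ∀ i, H.neighborSet (σ i : V) = Y \ G.neighborSet (σ i : V) := fun i => by
    ext v
    have h1 := (σ i).2
    have h2 := hdisj h1
    simp only [SimpleGraph.mem_neighborSet, H, Set.mem_sdiff]
    tauto
  have hHY : ∀ i, H.neighborSet (τ i : V) = X \ G.neighborSet (τ i : V) := fun i => by
    ext v
    have h1 := (τ i).2
    have h2 : (τ i : V) ∉ X := fun h => hdisj h h1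
    simp only [SimpleGraph.mem_neighborSet, H, Set.mem_sdiff]
    tauto
  refine ⟨H, ⟨X, Y, ⟨hXY.disjoint, fun v w h => h.1⟩, hcov, p, q,
    Fin.revPerm.trans σ, Fin.revPerm.trans τ, fun i j hij => ?_, fun i j hij => ?_⟩, ?_⟩
  · simp only [Equiv.trans_apply, hHX]
    exact Set.sdiff_subset_sdiff_right (hσ (Fin.rev_le_rev.2 hij))
  · simp only [Equiv.trans_apply, hHY]
    exact Set.sdiff_subset_sdiff_right (hτ (Fin.rev_le_rev.2 hij))
  · ext u v
    rw [SimpleGraph.compl_adj]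
    refine and_congr_right fun hne => ?_
    have : Nontrivial V := ⟨u, v, hne⟩
    obtain ⟨w, hw⟩ := hG.preconnected.exists_adj_of_nontrivial u
    obtain ⟨w', hw'⟩ := hG.preconnected.exists_adj_of_nontrivial v
    have hu : u ∈ X ∪ Y := hcov.ge (Set.mem_univ u)
    have hv : v ∈ X ∪ Y := hcov.ge (Set.mem_univ v)
    change G.edist u v ≤ 2 ↔ ¬ (((u ∈ X ∧ v ∈ Y) ∨ (u ∈ Y ∧ v ∈ X)) ∧ ¬ G.Adj u v)
    rcases hu with hu | hu <;> rcases hv with hv | hv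
    · have := edist_le_two_of_subset (neighborSet_subset_or_of_antitone σ hσ hu hv) hw hw'
      have := hdisj hu
      have := hdisj hv
      tauto
    · have := edist_le_two_iff_adj hXY hu hv
      tauto
    · have := edist_le_two_iff_adj hXY.symm hu hv
      tauto
    · have := edist_le_two_of_subset (neighborSet_subset_or_of_antitone τ hτ hu hv) hw hw'
      have : u ∉ X := fun h => hdisj h hu
      have : v ∉ X := fun h => hdisj h hv
      tauto

end Square

section Sides

variable {V : Type*} {G : SimpleGraph V} [Fintype V] [DecidableRel G.Adj]

/-- In a bipartite chain graph with an edge, the neighbours of a vertex of maximum degree form one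
side of the component that contains all edges. -/
theorem IsBipartiteChain.isCochain_of_degree_le (h : IsBipartiteChain G) {u : V}
    (hu : 0 < G.degree u) (hmax : ∀ v, G.degree v ≤ G.degree u) {X : Finset V}
    (hX : ∀ v, v ∈ X ↔ 0 < G.degree v ∧ ¬ G.Adj u v) :
    IsCochain (fun u v => G.edist u v ≤ 2) X (G.neighborFinset u) ∧ u ∈ X ∧
      ∀ x ∈ X, (∀ w, G.Adj x w → G.Adj u w) ∧
      ∀ y, G.Adj u y → (G.edist x y ≤ 2 ↔ G.Adj x y) := by
  obtain ⟨S, T, hST, hcov, hS, hT, huS⟩ : ∃ X Y : Set V, G.IsBipartiteWith X Y ∧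
      X ∪ Y = Set.univ ∧
      (∀ x ∈ X, ∀ x' ∈ X, G.neighborSet x ⊆ G.neighborSet x' ∨
        G.neighborSet x' ⊆ G.neighborSet x) ∧
      (∀ y ∈ Y, ∀ y' ∈ Y, G.neighborSet y ⊆ G.neighborSet y' ∨
        G.neighborSet y' ⊆ G.neighborSet y) ∧ u ∈ X := by
    obtain ⟨S, T, hST, hcov, hS, hT⟩ := h.exists_sides
    rcases hcov.ge (Set.mem_univ u) with hu | hu
    · exact ⟨S, T, hST, hcov, hS, hT, hu⟩
    · exact ⟨T, S, hST.symm, by rwa [Set.union_comm], hT, hS, hu⟩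
  have hdisj := Set.disjoint_left.1 hST.disjoint
  have hadj : ∀ v w, G.Adj v w → v ∈ S → w ∈ T := fun v w hvw hv =>
    (hST.mem_of_adj hvw).elim (fun h => h.2) fun h => absurd h.1 (hdisj hv)
  -- `u` is adjacent to all vertices of the other side that are not isolated
  have hdom : ∀ x ∈ S, ∀ w, G.Adj x w → G.Adj u w := by
    intro x hx w hxw
    rcases hS x hx u huS with h | h
    · exact h hxw
    · have hsub : G.neighborFinset u ⊆ G.neighborFinset x := fun v hv => by
        simpa using h (by simpa using hv)
      have := Finset.eq_of_subset_of_card_le hsub (by simpa using hmax x)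
      have hw : w ∈ G.neighborFinset x := by simpa using hxw
      rw [← this] at hw
      simpa using hw
  have hXS : ∀ x ∈ X, x ∈ S ∧ ∃ w, G.Adj x w := by
    intro x hx
    rw [hX, SimpleGraph.degree_pos_iff_exists_adj] at hx
    obtain ⟨⟨w, hw⟩, hux⟩ := hx
    refine ⟨?_, w, hw⟩
    rcases hcov.ge (Set.mem_univ x) with hx | hx
    · exact hx
    · have hwS : w ∈ S := (hST.mem_of_adj hw).elim (fun h => absurd hx (hdisj h.1)) fun h => h.2
      exact absurd (hdom w hwS x hw.symm) hux
  have hYT : ∀ y ∈ G.neighborFinset u, y ∈ T ∧ G.Adj y u := fun y hy => by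
    rw [SimpleGraph.mem_neighborFinset] at hy
    exact ⟨hadj u y hy huS, hy.symm⟩
  have hiff : ∀ x ∈ X, ∀ y ∈ G.neighborFinset u, G.edist x y ≤ 2 ↔ G.Adj x y :=
    fun x hx y hy => edist_le_two_iff_adj hST (hXS x hx).1 (hYT y hy).1
  have hiff' : ∀ x ∈ X, ∀ y ∈ G.neighborFinset u, G.edist y x ≤ 2 ↔ G.Adj y x :=
    fun x hx y hy => by rw [SimpleGraph.edist_comm, hiff x hx y hy, G.adj_comm]
  refine ⟨⟨fun v w h => by rwa [SimpleGraph.edist_comm], ?_, ?_, ?_, ?_, ?_, ?_⟩, ?_, ?_⟩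
  · rw [Finset.disjoint_left]
    exact fun x hx hx' => hdisj (hXS x hx).1 (hYT x hx').1
  · intro x hx x' hx'
    obtain ⟨hxS, w, hw⟩ := hXS x hx
    obtain ⟨hxS', w', hw'⟩ := hXS x' hx'
    exact edist_le_two_of_subset (hS x hxS x' hxS') hw hw'
  · intro y hy y' hy'
    obtain ⟨hyT, hyu⟩ := hYT y hy
    obtain ⟨hyT', hyu'⟩ := hYT y' hy'
    exact edist_le_two_of_subset (hT y hyT y' hyT') hyu hyu'
  · intro x hx x' hx'
    refine (hS x (hXS x hx).1 x' (hXS x' hx').1).imp (fun h y hy hxy => ?_) fun h y hy hxy => ?_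
    · exact (hiff x' hx' y hy).2 (h ((hiff x hx y hy).1 hxy))
    · exact (hiff x hx y hy).2 (h ((hiff x' hx' y hy).1 hxy))
  · intro y hy y' hy'
    refine (hT y (hYT y hy).1 y' (hYT y' hy').1).imp (fun h x hx hxy => ?_) fun h x hx hxy => ?_
    · exact (hiff' x hx y' hy').2 (h ((hiff' x hx y hy).1 hxy))
    · exact (hiff' x hx y hy).2 (h ((hiff' x hx y' hy').1 hxy))
  · intro v hvX hvY w hvw
    have h0 : ∀ w, ¬ G.Adj v w := by
      intro w hw
      rw [SimpleGraph.mem_neighborFinset] at hvY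
      rw [hX, SimpleGraph.degree_pos_iff_exists_adj] at hvX
      exact hvX ⟨⟨w, hw⟩, hvY⟩
    rcases edist_le_two_iff.1 hvw with h | h | ⟨w', h, -⟩
    · exact h
    · exact absurd h (h0 w)
    · exact absurd h (h0 w')
  · exact (hX u).2 ⟨hu, G.loopless.irrefl u⟩
  · exact fun x hx => ⟨hdom x (hXS x hx).1, fun y hy => hiff x hx y (by simpa using hy)⟩

end Sides

/-! ### Correctness of the output -/

section Output

variable {n : ℕ} {G : SimpleGraph (Fin n)} [DecidableRel G.Adj]

theorem isMaxD2TransitivityOutput_of_degree_eq_zero (hG : ∀ v, G.degree v = 0) {mem : ℕ → ℕ}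
    (h0 : mem 0 = 1 - (1 - n)) (hlab : ∀ v < n, mem (v + 1) = 0) :
    IsMaxD2TransitivityOutput n G mem := by
  have hadj : ∀ v w, ¬ G.Adj v w := fun v w h =>
    ((G.degree_pos_iff_exists_adj v).2 ⟨w, h⟩).ne' (hG v)
  have hR : IsCochain (fun u v => G.edist u v ≤ 2) (∅ : Finset (Fin n)) ∅ :=
    ⟨fun u v h => by rwa [SimpleGraph.edist_comm], by simp, by simp, by simp, by simp, by simp,
      fun u _ _ v h => by simpa [edist_le_two_iff, hadj] using h⟩
  obtain ⟨⟨P, hP⟩, hmax⟩ := isGreatest_d2Transitivity G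
  have h1 : d2Transitivity G ≤ mem 0 := by
    by_contra! hlt
    have hn := hP.1.le_card
    rw [Nat.card_fin] at hn
    have h2 : 2 ≤ d2Transitivity G := by omega
    obtain ⟨v, -, hv⟩ := hR.exists_mem_of_two_le hP h2 ⟨0, by omega⟩
    simp at hv
  have hpart : IsD2TransitivePartition G fun i : Fin (mem 0) =>
      {v : Fin n | mem ((v : ℕ) + 1) = i} := by
    have hval : ∀ i : Fin (mem 0), (i : ℕ) = 0 := fun i => by omega
    refine ⟨⟨fun i => ?_, fun i j hij => absurd (Fin.ext ((hval i).trans (hval j).symm)) hij, ?_⟩,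
      fun i j hij => absurd hij (by simp [Fin.lt_def, hval])⟩
    · have hn : 0 < n := by have := i.2; omega
      exact ⟨⟨0, hn⟩, by rw [Set.mem_ofPred_eq, hlab _ hn, hval]⟩
    · exact Set.eq_univ_of_forall fun v => Set.mem_iUnion.2
        ⟨⟨0, by have := v.2; omega⟩, hlab v v.2⟩
  exact ⟨le_antisymm (hmax ⟨_, hpart⟩) h1, hpart⟩

/-- The clique `A ∪ B` consists of `k - q` vertices `A` of `X` and of `k - p` neighbours `B` of some
`v ∈ X` whose degree is not larger than the degrees in `A`. -/
theorem isMaxD2TransitivityOutput_of_label (h : IsBipartiteChain G) {u : Fin n}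
    (hu : 0 < G.degree u) (hmax : ∀ v, G.degree v ≤ G.degree u) {X : Finset (Fin n)}
    (hX : ∀ v, v ∈ X ↔ 0 < G.degree v ∧ ¬ G.Adj u v) {k : ℕ} (hXk : X.card < k)
    (huk : G.degree u ≤ k) (hk : k ≤ X.card + G.degree u)
    (hub : ∀ k', X.card < k' →
      k' ≤ G.degree u + (X.filter fun x => k' - X.card ≤ G.degree x).card → k' ≤ k)
    {A B : Finset (Fin n)} (hA : A ⊆ X) (hAk : A.card = k - G.degree u) {v : Fin n} (hv : v ∈ X)
    (hvA : ∀ a ∈ A, G.degree v ≤ G.degree a) (hB : ∀ b ∈ B, G.Adj v b)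
    (hBk : B.card = k - X.card) {f : ℕ → ℕ} (hf : ∀ v : Fin n, f v =
      if v ∈ A ∨ v ∈ B then 2 else if v ∈ X then 0 else if G.Adj u v then 1 else 3)
    {mem : ℕ → ℕ} (h0 : mem 0 = k)
    (hlab : ∀ v < n, mem (v + 1) = label f (X.card + G.degree u - k) v) :
    IsMaxD2TransitivityOutput n G mem := by
  obtain ⟨hR, huX, hN⟩ := h.isCochain_of_degree_le hu hmax hX
  set Y := G.neighborFinset u with hY
  have hYc : Y.card = G.degree u := G.card_neighborFinset_eq_degree u
  have hcross : ∀ x ∈ X, crossDegree (fun u v => G.edist u v ≤ 2) Y x = G.degree x := by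
    classical
    intro x hx
    rw [crossDegree, ← G.card_neighborFinset_eq_degree]
    congr 1
    ext y
    simp only [Finset.mem_filter, hY, SimpleGraph.mem_neighborFinset]
    exact ⟨fun h => ((hN x hx).2 y h.1).1 h.2,
      fun h => ⟨(hN x hx).1 y h, ((hN x hx).2 y ((hN x hx).1 y h)).2 h⟩⟩
  have hBY : B ⊆ Y := fun b hb => by
    rw [hY, SimpleGraph.mem_neighborFinset]
    exact (hN v hv).1 b (hB b hb)
  have hAB : ∀ a ∈ A, ∀ b ∈ B, G.edist a b ≤ 2 := fun a ha b hb =>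
    hR.imp_of_crossDegree_le hv (hA ha) (by rw [hcross v hv, hcross a (hA ha)]; exact hvA a ha)
      (hBY hb) (edist_le_two_iff.2 (Or.inr (Or.inl (hB b hb))))
  have hAc := Finset.card_le_card hA
  have hBc := Finset.card_le_card hBY
  have hpart : IsD2TransitivePartition G fun i : Fin (mem 0) =>
      {v : Fin n | mem ((v : ℕ) + 1) = i} :=
    hR.isTransitiveFor_label hA hBY hAB (c := X.card + G.degree u - k) (by omega) (by omega)
      (by omega) (by omega) (f := f) (by simpa [hY] using hf)
      (lab := fun v : Fin n => mem ((v : ℕ) + 1)) fun v => hlab v v.2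
  obtain ⟨⟨P, hP⟩, hgr⟩ := isGreatest_d2Transitivity G
  refine ⟨le_antisymm (hgr ⟨_, hpart⟩) ?_, hpart⟩
  rw [h0]
  rcases le_or_gt (d2Transitivity G) X.card with hle | hlt
  · omega
  · have hX0 : 0 < X.card := Finset.card_pos.2 ⟨u, huX⟩
    obtain ⟨A', hA', B', hB', hkA, hkB, hAB'⟩ := hR.exists_biclique hP
      (hR.exists_mem_of_two_le hP (by omega))
    refine hub _ hlt ?_
    have hsub : A' ⊆ X.filter fun x => d2Transitivity G - X.card ≤ G.degree x := fun a ha => by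
      have := card_le_crossDegree (R := fun u v => G.edist u v ≤ 2) hB' (hAB' a ha)
      rw [hcross a (hA' ha)] at this
      exact Finset.mem_filter.2 ⟨hA' ha, by omega⟩
    have := Finset.card_le_card hsub
    omega

end Output

/-! ### The algorithms -/

/-- Outputs the transitivity of the complement of a bipartite chain graph. -/
def transitivityProgram : Program :=
  readDegrees ;; histogram ;; searchTransitivity ;; .store 0 8

/-- Outputs the `d₂`-transitivity of a bipartite chain graph and a `d₂`-transitive partition. For a
graph with edges, the marks of the vertices are in the end `0` for `X \ A`, `1` for `Y \ B`, `2`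
for the clique `A ∪ B`, and `3` for the isolated vertices. -/
def d2Program : Program :=
  readDegrees ;; .assign 23 (.copy 6) ;; .assign 24 (.const 1) ;;
  .branch 0 6
    (markList ;; histogram ;; searchD2 ;; select ;; .assign 23 (.copy 9) ;;
      .assign 24 (.const 2) ;; markList)
    (histogram ;; .assign 31 (.sub 1 2) ;; .assign 8 (.sub 1 31)) ;;
  writeLabels ;; .store 0 8

section Size

variable {n : ℕ} {G : SimpleGraph (Fin n)} {L : Fin n → List (Fin n)}

theorem IsAdjacencyLists.listLength_eq [DecidableRel G.Adj] (hL : IsAdjacencyLists G L)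
    (v : Fin n) : listLength L v = G.degree v := by
  rw [listLength_val, ← List.toFinset_card_of_nodup (hL v).1, ← G.card_neighborFinset_eq_degree]
  congr 1
  ext w
  simp [(hL v).2]

theorem IsAdjacencyLists.offset_eq (hL : IsAdjacencyLists G L) :
    offset L n = 1 + n + 2 * G.edgeSet.ncard := by
  classical
  have : ∑ j ∈ Finset.range n, listLength L j = 2 * G.edgeSet.ncard := by
    rw [Finset.sum_range, Finset.sum_congr rfl fun v _ => hL.listLength_eq v,
      G.sum_degrees_eq_twice_card_edges, ← SimpleGraph.coe_edgeFinset, Set.ncard_coe_finset]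
  rw [offset, Finset.sum_add_distrib, this]
  simp
  omega

theorem inputMem_entry (v : Fin n) {i : ℕ} (hi : i < (L v).length) :
    offset L v + 1 + i < offset L n ∧ inputMem L (offset L v + 1 + i) = (L v)[i] :=
  ⟨by
    have := offset_add_listLength_lt (L := L) v.2
    rw [listLength_val] at this
    omega, encode_getD_entry L v hi⟩

theorem runs_transitivityProgram {W : ℕ} (hW : 5 * offset L n + 10 ≤ W)
    (hL : IsAdjacencyLists G L) (hG : IsBipartiteChain Gᶜ) :
    Runs W transitivityProgram (initState L) fun t s =>
      t ≤ 100 * (n + 1) ∧ IsTransitivityOutput n G s.mem := by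
  classical
  simp only [transitivityProgram, runs_seq]
  refine (runs_readDegrees hW).mono fun t₁ s₁ ⟨ht₁, hs₁, _, _, _, hm₁⟩ => ?_
  refine (runs_histogram hW hs₁ hm₁ (by simp)).frame.mono fun t₂ s₂ ⟨⟨ht₂, hm₂⟩, hf₂⟩ => ?_
  have hs₂ : Frame L s₂ := hs₁.congr fun r hr => hf₂ r (by interval_cases r <;> rfl)
  have hgr := isGreatest_transitivity_of_compl hG
  refine (runs_searchTransitivity hW hs₂ (k := transitivity G) (hm₂.congr_hist fun j => by simp)
    (fun i hi => ?_) ?_).frame.mono fun t₃ s₃ ⟨⟨ht₃, h8⟩, hf₃⟩ => ?_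
  · rw [hL.listLength_eq ⟨i, hi⟩]
    simpa using G.degree_lt_card_verts ⟨i, hi⟩
  · convert hgr using 5 with k
    rw [card_filter_range_eq]
    simp only [hL.listLength_eq, true_and]
  · have h0 : s₃.reg 0 = 0 := by rw [hf₃ 0 rfl, hs₂.r0]
    rw [runs_store]
    refine ⟨by omega, ?_⟩
    simp [IsTransitivityOutput, h0, h8]

/-- The part of the algorithm that deals with the graphs that have an edge. -/
theorem runs_d2Program_of_degree_pos {W : ℕ} (hW : 5 * offset L n + 10 ≤ W)
    (hL : IsAdjacencyLists G L) (hG : IsBipartiteChain G) [DecidableRel G.Adj] {s : State}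
    (hs : Frame L s)
    (hm : Layout (inputMem L) (offset L n) n (fun _ => 0) (fun _ => 0) s.mem)
    (h5 : s.reg 5 = ((Finset.range n).filter fun i => 0 < listLength L i).card)
    {u : Fin n} (hu : 0 < G.degree u) (hmax : ∀ v, G.degree v ≤ G.degree u)
    (h6 : s.reg 6 = G.degree u) (h7 : s.reg 7 = offset L u) (h23 : s.reg 23 = G.degree u)
    (h24 : s.reg 24 = 1) :
    Runs W (markList ;; histogram ;; searchD2 ;; select ;; .assign 23 (.copy 9) ;;
      .assign 24 (.const 2) ;; markList) s
      fun t s' => t ≤ 150 * (n + 1) ∧ Frame L s' ∧ s'.reg 5 ≤ n ∧ ∃ f g : ℕ → ℕ,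
        Layout (inputMem L) (offset L n) n f g s'.mem ∧ (∀ v < n, f v ≤ 3) ∧
        ∀ mem : ℕ → ℕ, mem 0 = s'.reg 8 →
          (∀ v < n, mem (v + 1) = label f (s'.reg 5 - s'.reg 8) v) →
          IsMaxD2TransitivityOutput n G mem := by
  classical
  have hdeg : ∀ v : Fin n, listLength L v = G.degree v := hL.listLength_eq
  have hlen : ∀ v : Fin n, (L v).length = G.degree v := fun v => by rw [← hdeg, listLength_val]
  have hn1 : ∀ v : Fin n, G.degree v < n := fun v => by
    simpa using G.degree_lt_card_verts v
  set X : Finset (Fin n) := Finset.univ.filter fun v => 0 < G.degree v ∧ ¬ G.Adj u v with hXdef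
  have hX : ∀ v, v ∈ X ↔ 0 < G.degree v ∧ ¬ G.Adj u v := by simp [hXdef]
  set p := X.card with hp
  set q := G.degree u with hq
  have huX : u ∈ X := (hX u).2 ⟨hu, G.loopless.irrefl u⟩
  have hpos : 0 < p := Finset.card_pos.2 ⟨u, huX⟩
  have hpq : ((Finset.range n).filter fun i => 0 < listLength L i).card = p + q := by
    rw [card_filter_range_eq, hq, ← G.card_neighborFinset_eq_degree, hp,
      ← Finset.card_union_of_disjoint]
    · congr 1
      ext v
      have : G.Adj u v → 0 < G.degree v := fun h => (G.degree_pos_iff_exists_adj v).2 ⟨u, h.symm⟩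
      simp only [hdeg, Finset.mem_filter, Finset.mem_univ, true_and, Finset.mem_union, hX,
        SimpleGraph.mem_neighborFinset]
      tauto
    · rw [Finset.disjoint_left]
      intro v hv hv'
      exact ((hX v).1 hv).2 (by simpa using hv')
  have hpqn : p + q ≤ n := hpq ▸ card_filter_range_le n _
  -- the marks after the first step
  set l : List ℕ := (L u).map Fin.val with hl
  have hlu : ∀ v : Fin n, (v : ℕ) ∈ l ↔ G.Adj u v := fun v => by
    simp [hl, Fin.val_inj, (hL u).2]
  set f₁ : ℕ → ℕ := fun w => if w ∈ l then 1 else 0 with hf₁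
  have hf₁0 : ∀ v : Fin n, f₁ v = 0 ↔ ¬ G.Adj u v := fun v => by simp [hf₁, hlu]
  have hcount : ∀ j, 0 < j →
      ((Finset.range n).filter fun w => f₁ w = 0 ∧ j ≤ listLength L w).card =
        (X.filter fun x => j ≤ G.degree x).card := fun j hj => by
    rw [card_filter_range_eq]
    congr 1
    ext v
    simp only [hdeg, hf₁0, Finset.mem_filter, Finset.mem_univ, true_and, hX]
    constructor
    · exact fun h => ⟨⟨by omega, h.1⟩, h.2⟩
    · exact fun h => ⟨h.1.2, h.2⟩
  -- isolated vertices count here for `k ≤ p`, but the largest `k` exceeds `p`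
  obtain ⟨k, hk⟩ : ∃ k, IsGreatest {k | k ≤ q +
      ((Finset.range n).filter fun w => f₁ w = 0 ∧ k - p ≤ listLength L w).card} k := by
    have hb : BddAbove {k | k ≤ q +
        ((Finset.range n).filter fun w => f₁ w = 0 ∧ k - p ≤ listLength L w).card} :=
      ⟨q + n, fun k hk => le_trans hk (Nat.add_le_add_left (card_filter_range_le n _) q)⟩
    exact ⟨_, Nat.sSup_mem ⟨0, Nat.zero_le _⟩ hb, fun k hk => le_csSup hb hk⟩
  have hqk : q ≤ k := hk.2 (Nat.le_add_right _ _)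
  have hXall : (X.filter fun x => 1 ≤ G.degree x) = X :=
    Finset.filter_true_of_mem fun x hx => ((hX x).1 hx).1
  have hpk : p < k := hk.2 (by
    rw [Set.mem_ofPred_eq, Nat.succ_sub le_rfl, Nat.sub_self, hcount 1 one_pos, hXall]
    omega)
  have hkX : k ≤ q + (X.filter fun x => k - p ≤ G.degree x).card := by
    rw [← hcount _ (by omega)]
    exact hk.1
  have hkpq : k ≤ p + q := by
    have := Finset.card_filter_le X fun x => k - p ≤ G.degree x
    omega
  have hn := lt_offset L n
  have hoff := offset_add_listLength_lt (L := L) u.2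
  simp only [runs_seq, runs_assign, Operation.eval]
  refine (runs_markList hW hs hm l (by simp [hl, h23, hlen, hq]) (by simp [hl]) (fun i hi => ?_)
    (by omega)).frame.mono fun t₁ s₁ ⟨⟨ht₁, hm₁⟩, hr₁⟩ => ?_
  · rw [h7]
    simpa [hl] using inputMem_entry u (by simpa [hl] using hi)
  have hs₁ : Frame L s₁ := hs.congr fun r hr => hr₁ r (by interval_cases r <;> rfl)
  rw [h24] at hm₁
  refine (runs_histogram hW hs₁ hm₁ fun v _ => by split_ifs <;> omega).frame.mono
    fun t₂ s₂ ⟨⟨ht₂, hm₂⟩, hr₂⟩ => ?_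
  have hs₂ : Frame L s₂ := hs₁.congr fun r hr => hr₂ r (by interval_cases r <;> rfl)
  change Layout _ _ _ (fun w => if f₁ w = 0 ∧ listLength L w = 0 then 3 else f₁ w)
    (fun j => ((Finset.range n).filter fun w => f₁ w = 0 ∧ listLength L w + 1 = j).card) _ at hm₂
  set f₂ : ℕ → ℕ := fun w => if f₁ w = 0 ∧ listLength L w = 0 then 3 else f₁ w with hf₂
  have hf₂3 : ∀ v < n, f₂ v ≤ 3 := fun v _ => by
    simp only [hf₂, hf₁]
    split_ifs <;> omega
  refine (runs_searchD2 hW hs₂ hm₂ (p := p) (q := q) (by rw [hr₂ 5 rfl, hr₁ 5 rfl, h5, hpq])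
    (by rw [hr₂ 6 rfl, hr₁ 6 rfl, h6]) hpqn
    (fun i hi => by rw [hdeg ⟨i, hi⟩]; exact hmax _) hpk.le hk hkpq).frame.mono
    fun t₃ s₃ ⟨⟨ht₃, h8₃, h9₃, hm₃⟩, hr₃⟩ => ?_
  have hs₃ : Frame L s₃ := hs₂.congr fun r hr => hr₃ r (by interval_cases r <;> rfl)
  rw [← hm₃] at hm₂
  refine (runs_select hW hs₃ hm₂ hf₂3 (q := q) (u := u)
    (by rw [hr₃ 6 rfl, hr₂ 6 rfl, hr₁ 6 rfl, h6]) h8₃ h9₃ u.2 (hdeg u)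
    (by rw [hr₃ 7 rfl, hr₂ 7 rfl, hr₁ 7 rfl, h7]) (by omega) ?_).frame.mono
    fun t₄ s₄ ⟨⟨ht₄, A, hAk, hA, hm₄, v, h7₄, hv, hvA⟩, hr₄⟩ => ?_
  · have heq : ((Finset.range n).filter fun w => f₂ w = 0 ∧ k - p ≤ listLength L w) =
        (Finset.range n).filter fun w => f₁ w = 0 ∧ k - p ≤ listLength L w := by
      refine Finset.filter_congr fun w _ => ?_
      simp only [hf₂]
      split_ifs <;> omega
    rw [heq, hcount _ (by omega)]
    omega
  have hs₄ : Frame L s₄ := hs₃.congr fun r hr => hr₄ r (by interval_cases r <;> rfl)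
  have hAX : ∀ w : Fin n, (w : ℕ) ∈ A → w ∈ X := fun w hw => by
    obtain ⟨-, hw0, hwd⟩ := hA w hw
    rw [hdeg] at hwd
    rw [hX, ← hf₁0]
    refine ⟨by omega, ?_⟩
    simp only [hf₂] at hw0
    split_ifs at hw0 with h
    exact hw0
  have hvn : v < n := hv.elim (fun h => h ▸ u.2) fun h => (hA v h).1
  lift v to Fin n using hvn
  have hvX : v ∈ X := hv.elim (fun h => by rwa [Fin.ext h]) (hAX v)
  have hvd : k - p ≤ G.degree v := by
    rcases hv with hv | hv
    · rw [Fin.ext hv]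
      omega
    · rw [← hdeg]
      exact (hA v hv).2.2
  have hoffv := offset_add_listLength_lt (L := L) v.2
  set l₂ : List ℕ := ((L v).take (k - p)).map Fin.val with hl₂
  have hl₂len : l₂.length = k - p := by simp [hl₂, hlen, hvd]
  refine ⟨by rw [hr₄ 9 rfl, h9₃]; omega, by omega, ?_⟩
  refine (runs_markList (f := fun w => if w ∈ A then 2 else f₂ w)
    (g := fun j => ((Finset.range n).filter fun w => f₁ w = 0 ∧ listLength L w + 1 = j).card) hW (hs₄.congr fun r hr => ?_) (by exact hm₄) l₂
    (by simp [hl₂len, hr₄ 9 rfl, h9₃]) (fun w hw => ?_) (fun i hi => ?_)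
    (by simp [h7₄]; omega)).frame.mono fun t₅ s₅ ⟨⟨ht₅, hm₅⟩, hr₅⟩ => ?_
  · simp only [Function.update_apply]
    rw [if_neg (by omega), if_neg (by omega)]
  · obtain ⟨x, -, rfl⟩ := List.mem_map.1 hw
    exact x.2
  · have := inputMem_entry v (i := i) (by rw [hlen]; omega)
    simpa [hl₂, h7₄] using this
  have hs₅ : Frame L s₅ := hs₄.congr fun r hr => by
    rw [hr₅ r (by interval_cases r <;> rfl)]
    simp only [Function.update_apply]
    rw [if_neg (by omega), if_neg (by omega)]
  have h5₅ : s₅.reg 5 = p + q := by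
    rw [hr₅ 5 rfl]
    simp [hr₄ 5 rfl, hr₃ 5 rfl, hr₂ 5 rfl, hr₁ 5 rfl, h5, hpq]
  have h8₅ : s₅.reg 8 = k := by
    rw [hr₅ 8 rfl]
    simp [hr₄ 8 rfl, h8₃]
  have hllen : l.length = q := by simp [hl, hlen, hq]
  have hqn := hn1 u
  refine ⟨by omega, hs₅, by omega, fun w => if w ∈ l₂ then 2 else if w ∈ A then 2 else f₂ w, _,
    by simpa using hm₅, fun w hw => ?_, fun mem h0 hlab => ?_⟩
  · have := hf₂3 w hw
    dsimp only
    split_ifs <;> omega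
  rw [h5₅, h8₅] at hlab
  have hAcard : (Finset.univ.filter fun w : Fin n => (w : ℕ) ∈ A).card = A.card := by
    rw [← card_filter_range_eq fun w => w ∈ A, Finset.filter_mem_eq_inter,
      Finset.inter_eq_right.2 fun w hw => Finset.mem_range.2 (hA w hw).1]
  have hl₂mem : ∀ w : Fin n, (w : ℕ) ∈ l₂ ↔ w ∈ ((L v).take (k - p)).toFinset := fun w => by
    rw [List.mem_toFinset, hl₂, List.mem_map]
    exact ⟨by rintro ⟨x, hx, h⟩; exact Fin.ext h ▸ hx, fun h => ⟨w, h, rfl⟩⟩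
  refine isMaxD2TransitivityOutput_of_label hG hu hmax hX hpk hqk hkpq (fun k' hk' h => ?_)
    (A := Finset.univ.filter fun w : Fin n => (w : ℕ) ∈ A) (B := ((L v).take (k - p)).toFinset)
    (fun w hw => hAX w (Finset.mem_filter.1 hw).2) (hAcard.trans hAk) hvX (fun a ha => ?_)
    (fun b hb => ?_) ?_ (fun w => ?_) (h0.trans h8₅) hlab
  · refine hk.2 ?_
    rw [Set.mem_ofPred_eq, hcount _ (by omega)]
    exact h
  · rw [← hdeg, ← hdeg]
    exact hvA a (Finset.mem_filter.1 ha).2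
  · exact ((hL v).2 b).1 (List.mem_of_mem_take (List.mem_toFinset.1 hb))
  · rw [List.toFinset_card_of_nodup ((hL v).1.sublist (List.take_sublist _ _)), List.length_take,
      hlen]
    omega
  · have h0 : 0 < G.degree w ∨ ¬ G.Adj u w := by
      rw [or_iff_not_imp_right, not_not]
      exact fun h => (G.degree_pos_iff_exists_adj w).2 ⟨u, h.symm⟩
    simp only [hl₂mem, Finset.mem_filter, Finset.mem_univ, true_and, hf₂, hf₁, hlu, hdeg, hX]
    grind

theorem runs_d2Program {W : ℕ} (hW : 5 * offset L n + 10 ≤ W) (hL : IsAdjacencyLists G L)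
    (hG : IsBipartiteChain G) :
    Runs W d2Program (initState L) fun t s =>
      t ≤ 300 * (n + 1) ∧ IsMaxD2TransitivityOutput n G s.mem := by
  classical
  have hn := lt_offset L n
  have hdeg : ∀ v : Fin n, listLength L v = G.degree v := hL.listLength_eq
  simp only [d2Program, runs_seq (p := readDegrees)]
  refine (runs_readDegrees hW).mono fun t₁ s₁ ⟨ht₁, hs₁, h5, hle, h6, hm₁⟩ => ?_
  have h6W : s₁.reg 6 < W := by
    rcases h6 with h | ⟨u, hu, h, -⟩
    · omega
    · have := offset_add_listLength_lt (L := L) hu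
      omega
  rw [runs_seq, runs_assign, runs_seq, runs_assign, runs_seq]
  refine ⟨h6W, by simp [Operation.eval]; omega, ?_⟩
  set s₂ : State := ⟨Function.update (Function.update s₁.reg 23 (s₁.reg 6)) 24 1, s₁.mem⟩ with hs₂
  have hr₂ : ∀ r < 23, s₂.reg r = s₁.reg r := fun r hr => by
    simp only [hs₂, Function.update_apply]
    rw [if_neg (by omega), if_neg (by omega)]
  have hs₂F : Frame L s₂ := hs₁.congr fun r hr => hr₂ r (by omega)
  -- what both branches establish: marks from which the last pass makes a correct output
  suffices H : Runs W _ s₂ fun t s' => t ≤ 200 * (n + 1) ∧ Frame L s' ∧ s'.reg 5 ≤ n ∧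
      ∃ f g : ℕ → ℕ, Layout (inputMem L) (offset L n) n f g s'.mem ∧ (∀ v < n, f v ≤ 3) ∧
        ∀ mem : ℕ → ℕ, mem 0 = s'.reg 8 →
          (∀ v < n, mem (v + 1) = label f (s'.reg 5 - s'.reg 8) v) →
          IsMaxD2TransitivityOutput n G mem by
    refine H.mono fun t₃ s₃ ⟨ht₃, hs₃, h5₃, f, g, hm₃, hf, hout⟩ => ?_
    rw [runs_seq]
    refine (runs_writeLabels hW hs₃ hm₃ hf h5₃).frame.mono fun t₄ s₄ ⟨⟨ht₄, hlab⟩, hr₄⟩ => ?_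
    rw [runs_store]
    refine ⟨by omega, hout _ ?_ fun v hv => ?_⟩
    · simp [hr₄ 0 rfl, hs₃.r0, hr₄ 8 rfl]
    · rw [← hlab v hv, hr₄ 0 rfl, hs₃.r0]
      simp
  rw [runs_branch]
  rw [hs₂F.r0, hr₂ 6 (by omega)]
  constructor
  · intro hpos
    obtain ⟨u, hu, hu6, hu7⟩ := h6.resolve_left hpos.ne'
    have hdu : listLength L u = G.degree ⟨u, hu⟩ := hdeg ⟨u, hu⟩
    refine (runs_d2Program_of_degree_pos hW hL hG hs₂F hm₁ (by rw [hr₂ 5 (by omega), h5])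
      (u := ⟨u, hu⟩) (by omega) (fun v => ?_) (by rw [hr₂ 6 (by omega)]; omega)
      (by rw [hr₂ 7 (by omega), hu7]) (by simp [hs₂]; omega) (by simp [hs₂])).mono
      fun t s ⟨ht, h⟩ => ⟨by omega, h⟩
    rw [← hdeg, ← hdeg, hu6]
    exact hle v v.2
  · intro h0
    have hz : ∀ i < n, listLength L i = 0 := fun i hi => by have := hle i hi; omega
    rw [runs_seq]
    refine (runs_histogram hW hs₂F hm₁ (by simp)).frame.mono fun t₃ s₃ ⟨⟨ht₃, hm₃⟩, hr₃⟩ => ?_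
    have hs₃ : Frame L s₃ := hs₂F.congr fun r hr => hr₃ r (by interval_cases r <;> rfl)
    have hm₄ := hm₃.congr_mark (f' := fun _ => 3) fun v hv => by simp [hz v hv]
    simp only [runs_seq, runs_assign, Operation.eval]
    refine ⟨by simp [hs₃.r1]; omega, by simp [hs₃.r1]; omega, by omega,
      hs₃.congr fun r hr => ?_, ?_, _, _, hm₄, by simp, fun mem hmem hlab => ?_⟩
    · simp only [Function.update_apply]
      rw [if_neg (by omega), if_neg (by omega)]
    · simpa [hr₃ 5 rfl, hr₂ 5, h5] using card_filter_range_le n fun i => 0 < listLength L i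
    · refine isMaxD2TransitivityOutput_of_degree_eq_zero
        (fun v => by rw [← hdeg, hz v v.2]) ?_ fun v hv => ?_
      · simpa [hs₃.r1, hs₃.r2] using hmem
      · rw [hlab v hv]
        simp [label]

end Size


/-- Running times and addresses are linear in the size of the graph. -/
theorem solvableInLinearTime_of_runs {C : ∀ n : ℕ, SimpleGraph (Fin n) → Prop}
    {Correct : ∀ n : ℕ, SimpleGraph (Fin n) → (ℕ → ℕ) → Prop} (p : Program)
    (h : ∀ (n : ℕ) (G : SimpleGraph (Fin n)) (L : Fin n → List (Fin n)) (W : ℕ), C n G →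
      IsAdjacencyLists G L → 5 * offset L n + 10 ≤ W →
      Runs W p (initState L) fun t s => t ≤ 300 * (n + 1) ∧ Correct n G s.mem) :
    SolvableInLinearTime C Correct := by
  -- the input has `1 + n + 2 |E|` cells
  refine ⟨p, 300, fun n G hG L hL => ?_⟩
  have hsize : graphSize G = n + G.edgeSet.ncard + 1 := rfl
  have hoff := hL.offset_eq
  obtain ⟨t, s, he, ht, hc⟩ := h n G L (300 * graphSize G) hG hL (by omega)
  exact ⟨t, s, by omega, he, hc⟩

end D2Transitivity

theorem mainTheorem5 :
    D2Transitivity.SolvableInLinearTime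
        (fun _ G => D2Transitivity.IsBipartiteChain G)
        D2Transitivity.IsMaxD2TransitivityOutput ∧
      (∀ (V : Type*) (G : SimpleGraph V), G.Connected → D2Transitivity.IsBipartiteChain G →
        ∃ H : SimpleGraph V, D2Transitivity.IsBipartiteChain H ∧
          D2Transitivity.square G = Hᶜ) ∧
      D2Transitivity.SolvableInLinearTime
        (fun _ G => D2Transitivity.IsBipartiteChain Gᶜ)
        D2Transitivity.IsTransitivityOutput :=
  ⟨D2Transitivity.solvableInLinearTime_of_runs D2Transitivity.d2Program
      fun _ _ _ _ hG hL hW => D2Transitivity.runs_d2Program hW hL hG,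
    fun _ _ hconn hG => D2Transitivity.exists_square_eq_compl hconn hG,
    D2Transitivity.solvableInLinearTime_of_runs D2Transitivity.transitivityProgram
      fun _ _ _ _ hG hL hW => (D2Transitivity.runs_transitivityProgram hW hL hG).mono
        fun _ _ h => ⟨h.1.trans (by omega), h.2⟩⟩
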